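/- **Setting.** Let $N$ agents $i\in\mathcal V=\{1,\dots,N\}$ each have an optimal control problem with tunable parameter $\theta_i\in\mathbb R^r$: minimize $J_i=\sum_{t=0}^{T-1}c_{i,t}(x_t,u_t,\theta_i)+h_i(x_T,\theta_i)$ over $x_{1:T},u_{0:T-1}$ subject to $x_{t+1}=f_i(x_t,u_t,\theta_i)$ and a given $x_0=x_{i,0}$, where $x_t\in\mathbb R^n$, $u_t\in\mathbb R^m$ and $f_i,c_{i,t},h_i$ are twice differentiable. Assume that for every $\theta_i$ this problem has a unique solution $\xi_i(\theta_i)=(x_{i,0:T},u_{i,0:T-1})$, that $\xi_i$ is differentiable in $\theta_i$, and that the second-order sufficient condition holds at $\xi_i(\theta_i)$: with $\lambda_{i,T}=\partial h_i/\partial x_T$, $H_{i,t}=c_{i,t}+f_i'\lambda_{i,t+1}$, $\lambda_{i,t}=\partial H_{i,t}/\partial x_t$, and all derivatives evaluated along $\xi_i(\theta_i)$ with the multipliers $\lambda$ held fixed, $$\sum_{t=0}^{T-1}\begin{bmatrix}\delta x_t\\ \delta u_t\end{bmatrix}'\begin{bmatrix}H^{xx}_{i,t}&H^{xu}_{i,t}\\H^{ux}_{i,t}&H^{uu}_{i,t}\end{bmatrix}\begin{bmatrix}\delta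 x_t\\ \delta u_t\end{bmatrix}+\delta x_T'H^{xx}_{i,T}\delta x_T>0$$ for all $(\delta x,\delta u)\ne0$ with $\delta x_0=0$, $\delta x_{t+1}=F_{i,t}\delta x_t+G_{i,t}\delta u_t$. Here $F_{i,t},G_{i,t},E_{i,t}$ are the Jacobians of $f_i$ in $x,u,\theta$; $H^{xx}_{i,t},H^{xu}_{i,t},H^{ux}_{i,t},H^{uu}_{i,t},H^{x\theta}_{i,t},H^{u\theta}_{i,t}$ are the second partial derivatives of $H_{i,t}$; $H^{xx}_{i,T}$ and $H^{x\theta}_{i,T}$ are those of $h_i$. The *gradient generator* at $\theta_i$ is the linear quadratic problem of minimizing $$\mathrm{Tr}\sum_{t=0}^{T-1}\Big(\tfrac12\begin{bmatrix}X_t\\U_t\end{bmatrix}'\begin{bmatrix}H^{xx}_{i,t}&H^{xu}_{i,t}\\H^{ux}_{i,t}&H^{uu}_{i,t}\end{bmatrix}\begin{bmatrix}X_t\\U_t\end{bmatrix}+\begin{bmatrix}H^{x\theta}_{i,t}\\H^{u\theta}_{i,t}\end{bmatrix}'\begin{bmatrix}X_t\\U_t\end{bmatrix}\Big)+\mathrm{Tr}\Big(\tfrac12X_T'H^{xx}_{i,T}X_T+(H^{x\theta}_{i,T})'X_T\Big)$$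 over $X_t\in\mathbb R^{n\times r}$, $U_t\in\mathbb R^{m\times r}$ subject to $X_0=0$, $X_{t+1}=F_{i,t}X_t+G_{i,t}U_t+E_{i,t}$. Its output is a stationary solution $(X,U)$: a feasible point at which the derivative of the cost vanishes along all directions tangent to the constraints. If all $H^{uu}_{i,t}$ are invertible, the output may instead be computed by the following recursions. Put $A_t=F_t-G_t(H_t^{uu})^{-1}H_t^{ux}$, $R_t=G_t(H_t^{uu})^{-1}G_t'$, $M_t=E_t-G_t(H_t^{uu})^{-1}H_t^{u\theta}$, $Q_t=H_t^{xx}-H_t^{xu}(H_t^{uu})^{-1}H_t^{ux}$, $N_t=H_t^{x\theta}-H_t^{xu}(H_t^{uu})^{-1}H_t^{u\theta}$ (the index $i$ is dropped). With $P_T=H^{xx}_T$ and $W_T=H^{x\theta}_T$, compute backward $$P_t=Q_t+A_t'(I+P_{t+1}R_t)^{-1}P_{t+1}A_t,\qquad W_t=A_t'(I+P_{t+1}R_t)^{-1}(W_{t+1}+P_{t+1}M_t)+N_t,$$ and then, from $X_0=0$, compute forward $$U_t=-(H_t^{uu})^{-1}\big(H_t^{ux}X_t+H_t^{u\theta}+G_t'(I+P_{t+1}R_t)^{-1}(P_{t+1}A_tX_t+P_{t+1}M_t+W_{t+1})\big),\qquad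 X_{t+1}=F_tX_t+G_tU_t+E_t.$$ Let $L_i(\xi,\theta)$ be differentiable loss functions such that each $\theta\mapsto L_i(\xi_i(\theta),\theta)$ is convex on $\mathbb R^r$, and assume that the team problem $$\min_{\theta_1=\cdots=\theta_N}\ \frac1N\sum_{i=1}^NL_i(\xi_i(\theta_i),\theta_i)\tag{1}$$ has a solution. **Network.** At iteration $k=0,1,\dots$ agent $i$ has a neighbor set $\mathcal N_i(k)\ni i$ and weights $w_{ij}(k)$, and there is $\alpha>0$ with $w_{ij}(k)\ge\alpha$ for all $k$, $i$ and all $j\in\mathcal N_i(k)$. Let $W(k)$ be the matrix with entry $w_{ij}(k)$ if $j\in\mathcal N_i(k)$ and $0$ otherwise, and let $\mathbb G_k$ be the directed graph on $\mathcal V$ with an edge from $j$ to $i$ iff $j\in\mathcal N_i(k)$. Assume that every $W(k)$ is doubly stochastic and that there are positive integers $\tau,l$ such that for every $k\ge0$ the union of the graphs $\mathbb G_{kl+1+\tau},\dots,\mathbb G_{(k+1)l+\tau}$ is strongly connected. **Algorithm.** Let $\eta(k)>0$ with $\eta(k)\to0$, $\sum_k\eta(k)=\infty$, $\sum_k\eta(k)^2<\infty$,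 and from arbitrary initial values let $$\theta_i(k+1)=\sum_{j\in\mathcal N_i(k)}w_{ij}(k)\theta_j(k)-\eta(k)\,g_i(k),$$ where $g_i(k)$ is given by the chain rule $\frac{\partial L_i}{\partial\xi_i}\frac{\partial\xi_i}{\partial\theta_i}+\frac{\partial L_i}{\partial\theta_i}$ at $(\xi_i(\theta_i(k)),\theta_i(k))$, with $\frac{\partial\xi_i}{\partial\theta_i}$ replaced by the output $(X,U)$ of the gradient generator at $\theta_i(k)$. Assume that along the iterates the gradients of the losses grow at most linearly: there is $C$ with $$\Big\|\tfrac{d}{d\theta}L_i(\xi_i(\theta),\theta)\big|_{\theta=\theta_i(k)}\Big\|\le C\,(1+\|\theta_i(k)\|)\quad\text{for all }i,k$$ (for instance, the gradients are bounded, or Lipschitz in $\theta$). **Theorem.** There is $\theta^*\in\mathbb R^r$ such that $\theta_i(k)\to\theta^*$ as $k\to\infty$ for all $i\in\mathcal V$, and $\theta_1=\cdots=\theta_N=\theta^*$ solves the team problem (1). -/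

import Mathlib

open scoped Matrix Topology

noncomputable section

namespace CoopTuning

/-- Euclidean space `ℝ^p`. -/
abbrev Vec (p : ℕ) : Type := EuclideanSpace ℝ (Fin p)

/-- Trajectories `(x_{0:T}, u_{0:T-1})` with `x_t ∈ ℝ^n` and `u_t ∈ ℝ^m`. -/
abbrev Traj (n m T : ℕ) : Type := (Fin (T + 1) → Vec n) × (Fin T → Vec m)

/-- A map between normed spaces that is twice (Fréchet) differentiable everywhere. -/
def TwiceDifferentiable {V W : Type*} [NormedAddCommGroup V] [NormedSpace ℝ V]
    [NormedAddCommGroup W] [NormedSpace ℝ W] (g : V → W) : Prop :=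
  Differentiable ℝ g ∧ Differentiable ℝ (fderiv ℝ g)

/-- The Jacobian matrix of `g` at `z`: the entry `(a, b)` is `∂ g_a / ∂ z_b`. -/
def jacobian {p q : ℕ} (g : Vec p → Vec q) (z : Vec p) : Matrix (Fin q) (Fin p) ℝ :=
  Matrix.of fun a b => fderiv ℝ g z (EuclideanSpace.single b 1) a

/-! ### Linear quadratic control systems with matrix states -/

/-- The coefficients of the matrix-valued linear quadratic control problem with states
`X_t ∈ ℝ^{n × r}` and inputs `U_t ∈ ℝ^{m × r}`. -/
structure LQR (n m r T : ℕ) where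
  F : Fin T → Matrix (Fin n) (Fin n) ℝ
  G : Fin T → Matrix (Fin n) (Fin m) ℝ
  E : Fin T → Matrix (Fin n) (Fin r) ℝ
  Hxx : Fin T → Matrix (Fin n) (Fin n) ℝ
  Hxu : Fin T → Matrix (Fin n) (Fin m) ℝ
  Hux : Fin T → Matrix (Fin m) (Fin n) ℝ
  Huu : Fin T → Matrix (Fin m) (Fin m) ℝ
  Hxθ : Fin T → Matrix (Fin n) (Fin r) ℝ
  Huθ : Fin T → Matrix (Fin m) (Fin r) ℝ
  HxxT : Matrix (Fin n) (Fin n) ℝ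
  HxθT : Matrix (Fin n) (Fin r) ℝ

namespace LQR

variable {n m r T : ℕ} (S : LQR n m r T)

/-- The quadratic weight `[Hxx Hxu; Hux Huu]`. -/
def Qbar (t : Fin T) : Matrix (Fin n ⊕ Fin m) (Fin n ⊕ Fin m) ℝ :=
  Matrix.fromBlocks (S.Hxx t) (S.Hxu t) (S.Hux t) (S.Huu t)

/-- The linear weight `[Hxθ; Huθ]`. -/
def Rbar (t : Fin T) : Matrix (Fin n ⊕ Fin m) (Fin r) ℝ :=
  Matrix.fromRows (S.Hxθ t) (S.Huθ t)

/-- The cost of the linear quadratic problem. -/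
def cost (X : Fin (T + 1) → Matrix (Fin n) (Fin r) ℝ)
    (U : Fin T → Matrix (Fin m) (Fin r) ℝ) : ℝ :=
  Matrix.trace (∑ t : Fin T,
      ((1 / 2 : ℝ) • ((Matrix.fromRows (X t.castSucc) (U t))ᵀ * S.Qbar t *
          Matrix.fromRows (X t.castSucc) (U t))
        + (S.Rbar t)ᵀ * Matrix.fromRows (X t.castSucc) (U t)))
    + Matrix.trace ((1 / 2 : ℝ) • ((X (Fin.last T))ᵀ * S.HxxT * X (Fin.last T))
        + S.HxθTᵀ * X (Fin.last T))

/-- The constraints `X_0 = 0`, `X_{t+1} = F_t X_t + G_t U_t + E_t`. -/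
def Feasible (X : Fin (T + 1) → Matrix (Fin n) (Fin r) ℝ)
    (U : Fin T → Matrix (Fin m) (Fin r) ℝ) : Prop :=
  X 0 = 0 ∧ ∀ t : Fin T, X t.succ = S.F t * X t.castSucc + S.G t * U t + S.E t

/-- A stationary solution: a feasible point at which the derivative of the cost vanishes along
every direction that is tangent to the constraints. -/
def IsStationary (X : Fin (T + 1) → Matrix (Fin n) (Fin r) ℝ)
    (U : Fin T → Matrix (Fin m) (Fin r) ℝ) : Prop :=
  S.Feasible X U ∧
    ∀ (dX : Fin (T + 1) → Matrix (Fin n) (Fin r) ℝ) (dU : Fin T → Matrix (Fin m) (Fin r) ℝ),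
      dX 0 = 0 → (∀ t : Fin T, dX t.succ = S.F t * dX t.castSucc + S.G t * dU t) →
      HasDerivAt (fun s : ℝ => S.cost (X + s • dX) (U + s • dU)) 0 0

/-- `A_t = F_t - G_t Huu⁻¹ Hux`. -/
def A (t : Fin T) : Matrix (Fin n) (Fin n) ℝ := S.F t - S.G t * (S.Huu t)⁻¹ * S.Hux t

/-- `R_t = G_t Huu⁻¹ G_tᵀ`. -/
def R (t : Fin T) : Matrix (Fin n) (Fin n) ℝ := S.G t * (S.Huu t)⁻¹ * (S.G t)ᵀ

/-- `M_t = E_t - G_t Huu⁻¹ Huθ`. -/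
def M (t : Fin T) : Matrix (Fin n) (Fin r) ℝ := S.E t - S.G t * (S.Huu t)⁻¹ * S.Huθ t

/-- `Q_t = Hxx - Hxu Huu⁻¹ Hux`. -/
def Q (t : Fin T) : Matrix (Fin n) (Fin n) ℝ := S.Hxx t - S.Hxu t * (S.Huu t)⁻¹ * S.Hux t

/-- `N_t = Hxθ - Hxu Huu⁻¹ Huθ`. -/
def N (t : Fin T) : Matrix (Fin n) (Fin r) ℝ := S.Hxθ t - S.Hxu t * (S.Huu t)⁻¹ * S.Huθ t

/-- The pair `(P_t, W_t)` of the Riccati-type backward recursion, started from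
`P_T = HxxT` and `W_T = HxθT`. -/
def riccati : Fin (T + 1) → Matrix (Fin n) (Fin n) ℝ × Matrix (Fin n) (Fin r) ℝ :=
  Fin.reverseInduction
    (motive := fun _ => Matrix (Fin n) (Fin n) ℝ × Matrix (Fin n) (Fin r) ℝ)
    (S.HxxT, S.HxθT)
    (fun t PW =>
      (S.Q t + (S.A t)ᵀ * (1 + PW.1 * S.R t)⁻¹ * PW.1 * S.A t,
        (S.A t)ᵀ * (1 + PW.1 * S.R t)⁻¹ * (PW.2 + PW.1 * S.M t) + S.N t))

/-- The input `U_t` that the recursion assigns to the state `X_t = Xt`. -/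
def recInput (t : Fin T) (Xt : Matrix (Fin n) (Fin r) ℝ) : Matrix (Fin m) (Fin r) ℝ :=
  -((S.Huu t)⁻¹ * (S.Hux t * Xt + S.Huθ t
    + (S.G t)ᵀ * (1 + (S.riccati t.succ).1 * S.R t)⁻¹ *
      ((S.riccati t.succ).1 * S.A t * Xt + (S.riccati t.succ).1 * S.M t
        + (S.riccati t.succ).2)))

/-- The states `X_{0:T}` of the forward recursion, started from `X_0 = 0`. -/
def recX : Fin (T + 1) → Matrix (Fin n) (Fin r) ℝ :=
  Fin.induction (motive := fun _ => Matrix (Fin n) (Fin r) ℝ) 0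
    (fun t Xt => S.F t * Xt + S.G t * S.recInput t Xt + S.E t)

/-- The inputs `U_{0:T-1}` of the forward recursion. -/
def recU (t : Fin T) : Matrix (Fin m) (Fin r) ℝ := S.recInput t (S.recX t.castSucc)

/-- What the linear quadratic problem may return as its solution: a stationary solution found by
any method, or, when all the matrices `Huu` are invertible, the result of the recursions. -/
def IsOutput (X : Fin (T + 1) → Matrix (Fin n) (Fin r) ℝ)
    (U : Fin T → Matrix (Fin m) (Fin r) ℝ) : Prop :=
  S.IsStationary X U ∨ ((∀ t : Fin T, IsUnit (S.Huu t)) ∧ X = S.recX ∧ U = S.recU)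

/-- The second variation is positive on every nonzero solution of the linearized dynamics with
zero initial state. -/
def SecondVariationPos : Prop :=
  ∀ (dx : Fin (T + 1) → Fin n → ℝ) (du : Fin T → Fin m → ℝ),
    dx 0 = 0 → (∀ t : Fin T, dx t.succ = S.F t *ᵥ dx t.castSucc + S.G t *ᵥ du t) →
    (dx, du) ≠ 0 →
    0 < (∑ t : Fin T, Sum.elim (dx t.castSucc) (du t) ⬝ᵥ
          (S.Qbar t *ᵥ Sum.elim (dx t.castSucc) (du t)))
        + dx (Fin.last T) ⬝ᵥ (S.HxxT *ᵥ dx (Fin.last T))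

end LQR

/-! ### Parametrized optimal control systems -/

/-- The data of one optimal control system with a tunable parameter in `ℝ^r`: dynamics `f`,
running costs `c t`, final cost `h` and initial state `x0`. -/
structure OCSystem (n m r T : ℕ) where
  f : Vec n × Vec m × Vec r → Vec n
  c : Fin T → Vec n × Vec m × Vec r → ℝ
  h : Vec n × Vec r → ℝ
  x0 : Vec n

namespace OCSystem

variable {n m r T : ℕ} (S : OCSystem n m r T)

/-- The dynamics and the costs are twice differentiable. -/
def Smooth : Prop :=
  TwiceDifferentiable S.f ∧ (∀ t, TwiceDifferentiable (S.c t)) ∧ TwiceDifferentiable S.h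

/-- The objective function `J(x_{0:T}, u_{0:T-1}, θ)`. -/
def J (θ : Vec r) (ξ : Traj n m T) : ℝ :=
  (∑ t : Fin T, S.c t (ξ.1 t.castSucc, ξ.2 t, θ)) + S.h (ξ.1 (Fin.last T), θ)

/-- `ξ` starts at the given initial state and satisfies the dynamics with parameter `θ`. -/
def Feasible (θ : Vec r) (ξ : Traj n m T) : Prop :=
  ξ.1 0 = S.x0 ∧ ∀ t : Fin T, ξ.1 t.succ = S.f (ξ.1 t.castSucc, ξ.2 t, θ)

/-- `ξ` solves the optimal control problem with parameter `θ`. -/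
def IsOptimal (θ : Vec r) (ξ : Traj n m T) : Prop :=
  S.Feasible θ ξ ∧ ∀ ζ : Traj n m T, S.Feasible θ ζ → S.J θ ξ ≤ S.J θ ζ

/-- The Hamiltonian `H_t(x, u, θ, λ) = c_t(x, u, θ) + f(x, u, θ)ᵀ λ`. -/
def hamiltonian (t : Fin T) (x : Vec n) (u : Vec m) (θ : Vec r) (l : Vec n) : ℝ :=
  S.c t (x, u, θ) + inner ℝ (S.f (x, u, θ)) l

/-- The gradient of the Hamiltonian in the state. -/
def gradHx (t : Fin T) (x : Vec n) (u : Vec m) (θ : Vec r) (l : Vec n) : Vec n :=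
  gradient (fun x' => S.hamiltonian t x' u θ l) x

/-- The gradient of the Hamiltonian in the input. -/
def gradHu (t : Fin T) (x : Vec n) (u : Vec m) (θ : Vec r) (l : Vec n) : Vec m :=
  gradient (fun u' => S.hamiltonian t x u' θ l) u

/-- The gradient of the final cost in the state. -/
def gradhx (x : Vec n) (θ : Vec r) : Vec n := gradient (fun x' => S.h (x', θ)) x

/-- The Lagrange multipliers along the trajectory `ξ`: `λ_T = ∂h/∂x_T`, `λ_t = ∂H_t/∂x_t`
(the value at `t = 0` is not used). -/
def multiplier (θ : Vec r) (ξ : Traj n m T) : Fin (T + 1) → Vec n :=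
  Fin.reverseInduction (motive := fun _ => Vec n)
    (S.gradhx (ξ.1 (Fin.last T)) θ)
    (fun t l => S.gradHx t (ξ.1 t.castSucc) (ξ.2 t) θ l)

/-- The gradient generator: the auxiliary linear quadratic problem determined by the parameter
`θ` and the trajectory `ξ`. Second derivatives of the Hamiltonian are taken with the multiplier
held fixed. -/
def gradientGenerator (θ : Vec r) (ξ : Traj n m T) : LQR n m r T where
  F t := jacobian (fun x => S.f (x, ξ.2 t, θ)) (ξ.1 t.castSucc)
  G t := jacobian (fun u => S.f (ξ.1 t.castSucc, u, θ)) (ξ.2 t)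
  E t := jacobian (fun ϑ => S.f (ξ.1 t.castSucc, ξ.2 t, ϑ)) θ
  Hxx t := jacobian (fun x => S.gradHx t x (ξ.2 t) θ (S.multiplier θ ξ t.succ)) (ξ.1 t.castSucc)
  Hxu t := jacobian
    (fun u => S.gradHx t (ξ.1 t.castSucc) u θ (S.multiplier θ ξ t.succ)) (ξ.2 t)
  Hux t := jacobian (fun x => S.gradHu t x (ξ.2 t) θ (S.multiplier θ ξ t.succ)) (ξ.1 t.castSucc)
  Huu t := jacobian
    (fun u => S.gradHu t (ξ.1 t.castSucc) u θ (S.multiplier θ ξ t.succ)) (ξ.2 t)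
  Hxθ t := jacobian
    (fun ϑ => S.gradHx t (ξ.1 t.castSucc) (ξ.2 t) ϑ (S.multiplier θ ξ t.succ)) θ
  Huθ t := jacobian
    (fun ϑ => S.gradHu t (ξ.1 t.castSucc) (ξ.2 t) ϑ (S.multiplier θ ξ t.succ)) θ
  HxxT := jacobian (fun x => S.gradhx x θ) (ξ.1 (Fin.last T))
  HxθT := jacobian (fun ϑ => S.gradhx (ξ.1 (Fin.last T)) ϑ) θ

end OCSystem

/-- The right-hand side of the chain rule, `∂L/∂ξ · [X; U] + ∂L/∂θ`, as a vector of `ℝ^r`, with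
the matrices `X_t`, `U_t` in the place of `∂x_t/∂θ`, `∂u_t/∂θ`. -/
def chainRuleGradient {n m r T : ℕ} (L : Traj n m T × Vec r → ℝ) (ξ : Traj n m T) (θ : Vec r)
    (X : Fin (T + 1) → Matrix (Fin n) (Fin r) ℝ) (U : Fin T → Matrix (Fin m) (Fin r) ℝ) :
    Vec r :=
  WithLp.toLp 2 fun b : Fin r =>
    fderiv ℝ (fun ζ => L (ζ, θ)) ξ
        (fun t => WithLp.toLp 2 fun a => X t a b, fun t => WithLp.toLp 2 fun a => U t a b)
      + fderiv ℝ (fun ϑ => L (ξ, ϑ)) θ (EuclideanSpace.single b 1)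

/-! ### The network and the team problem -/

/-- The weight matrix: the `ij` entry is `w i j` if `j` is a neighbor of `i`, and `0` otherwise. -/
def weightMatrix {N : ℕ} (nbr : Fin N → Finset (Fin N)) (w : Fin N → Fin N → ℝ) :
    Matrix (Fin N) (Fin N) ℝ :=
  Matrix.of fun i j => if j ∈ nbr i then w i j else 0

/-- The edge relation of the union of the graphs with index in `K`; there is an edge from `j` to
`i` in the `k`-th graph iff `j ∈ nbr k i`. -/
def UnionEdge {N : ℕ} (nbr : ℕ → Fin N → Finset (Fin N)) (K : Finset ℕ) (j i : Fin N) : Prop :=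
  ∃ k ∈ K, j ∈ nbr k i

/-- The directed graph with edge relation `e` is strongly connected. -/
def StronglyConnected {V : Type*} (e : V → V → Prop) : Prop :=
  ∀ i j : V, Relation.ReflTransGen e i j

/-- The team-average loss as a function of the parameters of all the agents, where the trajectory
of agent `i` is `ξ i` at its own parameter. -/
def teamLoss {N n m r T : ℕ} (L : Fin N → Traj n m T × Vec r → ℝ)
    (ξ : Fin N → Vec r → Traj n m T) (ϑ : Fin N → Vec r) : ℝ :=
  (1 / (N : ℝ)) * ∑ i, L i (ξ i (ϑ i), ϑ i)

/-- The common parameter `θs` minimizes the team-average loss among all consensus parameters. -/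
def SolvesTuning {N n m r T : ℕ} (L : Fin N → Traj n m T × Vec r → ℝ)
    (ξ : Fin N → Vec r → Traj n m T) (θs : Vec r) : Prop :=
  ∀ ϑ : Fin N → Vec r, (∀ i j, ϑ i = ϑ j) → teamLoss L ξ (fun _ => θs) ≤ teamLoss L ξ ϑ

end CoopTuning

end

/-! The proof has two independent halves: the vectors `g_i(k)` are true gradients, and distributed
gradient descent on convex functions converges.

Gradients. The first-order conditions of the control problem hold identically in the parameter.
Differentiating them shows that the Jacobians of states, inputs and multipliers satisfy the
first-order system of the gradient generator (`OCSystem.Smooth.isKKT_jacobian`). Positivity of the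
second variation leaves room for only one stationary point (`LQR.IsKKT.eq_of_isStationary`). It also
makes every `I + P R` in the recursions invertible, so the recursions reproduce the same point
(`LQR.IsKKT.eq_rec`). The chain rule then yields the gradient of the reduced loss.

Convergence. The agents' parameters are stacked into one vector `z` of a Euclidean product, with `K`
the consensus subspace. The update becomes `z ↦ M k z - η k • ∇F z` with `F` a separable convex sum.
Double stochasticity makes `M k` nonexpansive, the identity on `K`, and invariant on `Kᗮ`. Joint
connectivity and the lower bound on the weights make products over a window contract `Kᗮ` uniformly
(`exists_isMixing`). For a minimizer `s` of `F` on `K`, a combination of `‖z - s‖ ^ 2` and an energy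
of the disagreement is almost decreasing, with errors of order `η ^ 2`. Hence `‖z - s‖` converges,
the disagreement vanishes, and `η` times the Bregman distance from `s` is summable
(`IsMixing.gradient_iteration_of_minimizer`). Since `∑ η = ∞`, some cluster point minimizes `F` on
`K`. Taking it as the new `s` upgrades subsequential to full convergence
(`IsMixing.tendsto_gradient_iteration`). -/

namespace CoopTuning

/-! ### Linear quadratic problem: optimality system and uniqueness of the stationary point -/

namespace LQR

variable {n m r T : ℕ} (S : LQR n m r T)

/-- The quadratic weights are symmetric. -/
structure IsSymm : Prop where
  xx : ∀ t, (S.Hxx t)ᵀ = S.Hxx t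
  uu : ∀ t, (S.Huu t)ᵀ = S.Huu t
  ux : ∀ t, (S.Hux t)ᵀ = S.Hxu t
  xxT : S.HxxTᵀ = S.HxxT

/-- The first-order optimality system of the linear quadratic problem with costate `Y`. -/
structure IsKKT (X : Fin (T + 1) → Matrix (Fin n) (Fin r) ℝ)
    (U : Fin T → Matrix (Fin m) (Fin r) ℝ)
    (Y : Fin (T + 1) → Matrix (Fin n) (Fin r) ℝ) : Prop where
  feasible : S.Feasible X U
  final : Y (Fin.last T) = S.HxxT * X (Fin.last T) + S.HxθT
  costate : ∀ t : Fin T, Y t.castSucc =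
    S.Hxx t * X t.castSucc + S.Hxu t * U t + S.Hxθ t + (S.F t)ᵀ * Y t.succ
  input : ∀ t : Fin T,
    S.Hux t * X t.castSucc + S.Huu t * U t + S.Huθ t + (S.G t)ᵀ * Y t.succ = 0

variable {S}

theorem IsSymm.xu (h : S.IsSymm) (t : Fin T) : (S.Hxu t)ᵀ = S.Hux t := by
  rw [← h.ux, Matrix.transpose_transpose]

theorem IsSymm.qbar (h : S.IsSymm) (t : Fin T) : (S.Qbar t)ᵀ = S.Qbar t := by
  rw [Qbar, Matrix.fromBlocks_transpose, h.xx, h.uu, h.ux, h.xu]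

theorem sum_succ_sub_castSucc {T : ℕ} (a : Fin (T + 1) → ℝ) :
    ∑ t : Fin T, (a t.succ - a t.castSucc) = a (Fin.last T) - a 0 := by
  have h1 := Fin.sum_univ_succ a
  have h2 := Fin.sum_univ_castSucc a
  rw [Finset.sum_sub_distrib]
  linarith

theorem trace_transpose_mul_eq_sum {ι κ : Type*} [Fintype ι] [Fintype κ]
    (A : Matrix ι ι ℝ) (D : Matrix ι κ ℝ) :
    Matrix.trace (Dᵀ * (A * D)) = ∑ b, (fun a => D a b) ⬝ᵥ (A *ᵥ fun a => D a b) := by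
  simp [Matrix.trace, Matrix.mul_apply, dotProduct, Matrix.mulVec]

/-- The derivative of the cost at `(X, U)` in the direction `(dX, dU)`. -/
def dcost (S : LQR n m r T) (X : Fin (T + 1) → Matrix (Fin n) (Fin r) ℝ)
    (U : Fin T → Matrix (Fin m) (Fin r) ℝ) (dX : Fin (T + 1) → Matrix (Fin n) (Fin r) ℝ)
    (dU : Fin T → Matrix (Fin m) (Fin r) ℝ) : ℝ :=
  ∑ t : Fin T, Matrix.trace ((Matrix.fromRows (dX t.castSucc) (dU t))ᵀ *
      (S.Qbar t * Matrix.fromRows (X t.castSucc) (U t) + S.Rbar t))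
    + Matrix.trace ((dX (Fin.last T))ᵀ * (S.HxxT * X (Fin.last T) + S.HxθT))

theorem trace_quadratic_add_smul {ι κ : Type*} [Fintype ι] [Fintype κ]
    {A : Matrix ι ι ℝ} (hA : Aᵀ = A) (B Z D : Matrix ι κ ℝ) (s : ℝ) :
    Matrix.trace ((1 / 2 : ℝ) • ((Z + s • D)ᵀ * A * (Z + s • D)) + Bᵀ * (Z + s • D))
      = Matrix.trace ((1 / 2 : ℝ) • (Zᵀ * A * Z) + Bᵀ * Z)
        + s * Matrix.trace (Dᵀ * (A * Z + B))
        + s ^ 2 * (1 / 2 * Matrix.trace (Dᵀ * A * D)) := by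
  have h1 : Matrix.trace (Zᵀ * A * D) = Matrix.trace (Dᵀ * A * Z) := by
    rw [← Matrix.trace_transpose]
    simp [Matrix.transpose_mul, hA, Matrix.mul_assoc]
  have h2 : Matrix.trace (Bᵀ * D) = Matrix.trace (Dᵀ * B) := by
    rw [← Matrix.trace_transpose]
    simp [Matrix.transpose_mul]
  simp only [Matrix.transpose_add, Matrix.transpose_smul, Matrix.add_mul, Matrix.mul_add,
    Matrix.smul_mul, Matrix.mul_smul, Matrix.trace_add, Matrix.trace_smul, smul_eq_mul,
    smul_add, h1, h2, ← Matrix.mul_assoc]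
  ring

theorem fromRows_add_smul {k : ℕ} (A dA : Matrix (Fin n) (Fin k) ℝ)
    (B dB : Matrix (Fin m) (Fin k) ℝ) (s : ℝ) :
    Matrix.fromRows (A + s • dA) (B + s • dB)
      = Matrix.fromRows A B + s • Matrix.fromRows dA dB := by
  ext (i | i) j <;> simp

/-- Along a line the cost is exactly a quadratic polynomial in `s`; symmetry of the weights merges
its two cross terms into `dcost`. -/
theorem hasDerivAt_cost (hS : S.IsSymm) (X dX : Fin (T + 1) → Matrix (Fin n) (Fin r) ℝ)
    (U dU : Fin T → Matrix (Fin m) (Fin r) ℝ) :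
    HasDerivAt (fun s : ℝ => S.cost (X + s • dX) (U + s • dU)) (S.dcost X U dX dU) 0 := by
  have key : ∃ q : ℝ, (fun s : ℝ => S.cost (X + s • dX) (U + s • dU))
      = fun s => S.cost X U + s * S.dcost X U dX dU + s ^ 2 * q := by
    refine ⟨∑ t : Fin T, 1 / 2 * Matrix.trace ((Matrix.fromRows (dX t.castSucc) (dU t))ᵀ *
      S.Qbar t * Matrix.fromRows (dX t.castSucc) (dU t))
      + 1 / 2 * Matrix.trace ((dX (Fin.last T))ᵀ * S.HxxT * dX (Fin.last T)), ?_⟩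
    funext s
    simp only [cost, dcost, Pi.add_apply, Pi.smul_apply, fromRows_add_smul, Matrix.trace_sum]
    simp only [trace_quadratic_add_smul (hS.qbar _), trace_quadratic_add_smul hS.xxT,
      Finset.sum_add_distrib, mul_add, Finset.mul_sum]
    ring
  obtain ⟨q, hq⟩ := key
  rw [hq]
  have h := (((hasDerivAt_id (0 : ℝ)).mul_const (S.dcost X U dX dU)).const_add
    (S.cost X U)).add (((hasDerivAt_id (0 : ℝ)).pow 2).mul_const q)
  exact h.congr_deriv (by simp)

/-- By the costate and input equations, the stage-`t` derivative is the negative increment of `tr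
(dXᵀ Y)`. The sum telescopes: the term at `0` vanishes with `dX 0`, and the one at the end cancels
the final cost. -/
theorem IsKKT.dcost_eq_zero {X Y : Fin (T + 1) → Matrix (Fin n) (Fin r) ℝ}
    {U : Fin T → Matrix (Fin m) (Fin r) ℝ} (h : S.IsKKT X U Y)
    {dX : Fin (T + 1) → Matrix (Fin n) (Fin r) ℝ} {dU : Fin T → Matrix (Fin m) (Fin r) ℝ}
    (h0 : dX 0 = 0) (hd : ∀ t : Fin T, dX t.succ = S.F t * dX t.castSucc + S.G t * dU t) :
    S.dcost X U dX dU = 0 := by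
  have hstep : ∀ t : Fin T, Matrix.trace ((Matrix.fromRows (dX t.castSucc) (dU t))ᵀ *
      (S.Qbar t * Matrix.fromRows (X t.castSucc) (U t) + S.Rbar t))
      = -(Matrix.trace ((dX t.succ)ᵀ * Y t.succ)
        - Matrix.trace ((dX t.castSucc)ᵀ * Y t.castSucc)) := by
    intro t
    have hx := h.costate t
    have hu := h.input t
    have e1 : S.Qbar t * Matrix.fromRows (X t.castSucc) (U t) + S.Rbar t
        = Matrix.fromRows (Y t.castSucc - (S.F t)ᵀ * Y t.succ) (-((S.G t)ᵀ * Y t.succ)) := by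
      rw [Qbar, Rbar, Matrix.fromBlocks_mul_fromRows, hx, ← eq_neg_of_add_eq_zero_left hu]
      ext (i | i) j <;> simp
    rw [e1, Matrix.transpose_fromRows, Matrix.fromCols_mul_fromRows, hd t]
    simp only [Matrix.transpose_add, Matrix.transpose_mul, Matrix.add_mul, Matrix.mul_sub,
      Matrix.mul_neg, Matrix.trace_add, Matrix.trace_sub, Matrix.trace_neg, Matrix.mul_assoc]
    ring
  rw [dcost, Finset.sum_congr rfl fun t _ => hstep t, Finset.sum_neg_distrib,
    sum_succ_sub_castSucc fun t => Matrix.trace ((dX t)ᵀ * Y t), h0, h.final]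
  simp

/-- The trace splits into one second variation per column. Each is nonnegative, so a zero sum forces
each to vanish, and positivity then kills the column. -/
theorem eq_zero_of_sum_trace_eq_zero (hpos : S.SecondVariationPos)
    {dX : Fin (T + 1) → Matrix (Fin n) (Fin r) ℝ} {dU : Fin T → Matrix (Fin m) (Fin r) ℝ}
    (h0 : dX 0 = 0) (hd : ∀ t : Fin T, dX t.succ = S.F t * dX t.castSucc + S.G t * dU t)
    (hz : ∑ t : Fin T, Matrix.trace ((Matrix.fromRows (dX t.castSucc) (dU t))ᵀ *
      (S.Qbar t * Matrix.fromRows (dX t.castSucc) (dU t)))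
      + Matrix.trace ((dX (Fin.last T))ᵀ * (S.HxxT * dX (Fin.last T))) = 0) :
    dX = 0 ∧ dU = 0 := by
  set x : Fin r → Fin (T + 1) → Fin n → ℝ := fun b t a => dX t a b with hx
  set u : Fin r → Fin T → Fin m → ℝ := fun b t a => dU t a b with hu
  set q : Fin r → ℝ := fun b => (∑ t : Fin T, Sum.elim (x b t.castSucc) (u b t) ⬝ᵥ
      (S.Qbar t *ᵥ Sum.elim (x b t.castSucc) (u b t)))
    + x b (Fin.last T) ⬝ᵥ (S.HxxT *ᵥ x b (Fin.last T)) with hq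
  have hcol : ∀ b t, (fun a => Matrix.fromRows (dX (Fin.castSucc t)) (dU t) a b)
      = Sum.elim (x b t.castSucc) (u b t) := by
    intro b t
    ext (i | i) <;> simp [hx, hu]
  have hsum : ∑ b, q b = 0 := by
    rw [← hz]
    simp only [trace_transpose_mul_eq_sum, hcol, hq, Finset.sum_add_distrib]
    rw [Finset.sum_comm]
  have hqpos : ∀ b, (x b, u b) ≠ 0 → 0 < q b := by
    intro b hb
    refine hpos (x b) (u b) ?_ ?_ hb
    · ext a; simp [hx, h0]
    · intro t
      ext a
      simp [hx, hu, hd t, Matrix.mul_apply, Matrix.mulVec, dotProduct]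
  have hqnn : ∀ b, 0 ≤ q b := by
    intro b
    by_cases hb : (x b, u b) = 0
    · obtain ⟨h1, h2⟩ := Prod.mk_eq_zero.1 hb
      simp [hq, h1, h2]
    · exact (hqpos b hb).le
  have hzero : ∀ b, (x b, u b) = 0 := by
    intro b
    by_contra hb
    have := (Finset.sum_eq_zero_iff_of_nonneg fun b _ => hqnn b).1 hsum b (Finset.mem_univ b)
    exact (hqpos b hb).ne' this
  constructor
  · ext t a b
    exact congrFun (congrFun (Prod.mk_eq_zero.1 (hzero b)).1 t) a
  · ext t a b
    exact congrFun (congrFun (Prod.mk_eq_zero.1 (hzero b)).2 t) a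

/-- The difference of the two points is an admissible direction in which `dcost` vanishes at both.
As `dcost` is affine in the base point, subtraction leaves the second variation of the difference
itself. -/
theorem IsKKT.eq_of_isStationary (hS : S.IsSymm) (hpos : S.SecondVariationPos)
    {X Y X' : Fin (T + 1) → Matrix (Fin n) (Fin r) ℝ} {U U' : Fin T → Matrix (Fin m) (Fin r) ℝ}
    (h : S.IsKKT X U Y) (h' : S.IsStationary X' U') : X' = X ∧ U' = U := by
  have h0 : (X' - X) 0 = 0 := by simp [h'.1.1, h.feasible.1]
  have hd : ∀ t : Fin T, (X' - X) t.succ = S.F t * (X' - X) t.castSucc + S.G t * (U' - U) t := by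
    intro t
    simp only [Pi.sub_apply, h'.1.2 t, h.feasible.2 t, Matrix.mul_sub]
    abel
  have e1 := h.dcost_eq_zero h0 hd
  have e2 := (hasDerivAt_cost hS X' (X' - X) U' (U' - U)).unique (h'.2 _ _ h0 hd)
  have := eq_zero_of_sum_trace_eq_zero hpos h0 hd (by
    have e3 := sub_eq_zero.2 (e2.trans e1.symm)
    have hf : ∀ t : Fin T, Matrix.fromRows ((X' - X) t.castSucc) ((U' - U) t)
        = Matrix.fromRows (X' t.castSucc) (U' t) - Matrix.fromRows (X t.castSucc) (U t) := by
      intro t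
      ext (i | i) j <;> simp
    rw [← e3, dcost, dcost, add_sub_add_comm, ← Finset.sum_sub_distrib]
    congr 1
    · refine Finset.sum_congr rfl fun t _ => ?_
      rw [← Matrix.trace_sub, ← Matrix.mul_sub, add_sub_add_right_eq_sub, ← Matrix.mul_sub, hf t]
    · rw [← Matrix.trace_sub, ← Matrix.mul_sub, add_sub_add_right_eq_sub, ← Matrix.mul_sub]
      rfl)
  exact ⟨sub_eq_zero.1 this.1, sub_eq_zero.1 this.2⟩

/-! ### Riccati recursion: well-posedness and agreement with the optimality system -/

variable {n m r T : ℕ} {S : LQR n m r T}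

variable (S) in
theorem riccati_last : S.riccati (Fin.last T) = (S.HxxT, S.HxθT) := by
  rw [riccati, Fin.reverseInduction_last]

variable (S) in
theorem riccati_castSucc (t : Fin T) : S.riccati t.castSucc =
    (S.Q t + (S.A t)ᵀ * (1 + (S.riccati t.succ).1 * S.R t)⁻¹ * (S.riccati t.succ).1 * S.A t,
      (S.A t)ᵀ * (1 + (S.riccati t.succ).1 * S.R t)⁻¹ *
        ((S.riccati t.succ).2 + (S.riccati t.succ).1 * S.M t) + S.N t) := by
  rw [riccati, Fin.reverseInduction_castSucc]

theorem IsSymm.transpose_A (hS : S.IsSymm) (t : Fin T) :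
    (S.A t)ᵀ = (S.F t)ᵀ - S.Hxu t * (S.Huu t)⁻¹ * (S.G t)ᵀ := by
  rw [A, Matrix.transpose_sub, Matrix.transpose_mul, Matrix.transpose_mul,
    Matrix.transpose_nonsing_inv, hS.uu, hS.ux, Matrix.mul_assoc]

/-- The value of the quadratic form `[x; u]ᵀ Qbar [x; u]` at time `t`. -/
def stage (S : LQR n m r T) (t : Fin T) (x : Fin n → ℝ) (u : Fin m → ℝ) : ℝ :=
  Sum.elim x u ⬝ᵥ (S.Qbar t *ᵥ Sum.elim x u)

theorem stage_eq (t : Fin T) (x : Fin n → ℝ) (u : Fin m → ℝ) :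
    S.stage t x u = x ⬝ᵥ (S.Hxx t *ᵥ x + S.Hxu t *ᵥ u) + u ⬝ᵥ (S.Hux t *ᵥ x + S.Huu t *ᵥ u) := by
  rw [stage, Qbar, Matrix.fromBlocks_mulVec, sumElim_dotProduct_sumElim]
  rfl

@[simp] theorem stage_zero (t : Fin T) : S.stage t 0 0 = 0 := by
  simp [stage_eq]

/-- From the state `z` at time `t`, the cost-to-go `zᵀ P z` is attained, where earlier
states and inputs vanish. -/
def CostToGo (S : LQR n m r T) (t : Fin (T + 1)) (P : Matrix (Fin n) (Fin n) ℝ) : Prop :=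
  ∀ z : Fin n → ℝ, ∃ (dx : Fin (T + 1) → Fin n → ℝ) (du : Fin T → Fin m → ℝ),
    (∀ s < t, dx s = 0) ∧ (∀ s : Fin T, s.castSucc < t → du s = 0) ∧ dx t = z ∧
    (∀ s : Fin T, t ≤ s.castSucc → dx s.succ = S.F s *ᵥ dx s.castSucc + S.G s *ᵥ du s) ∧
    (∑ s, S.stage s (dx s.castSucc) (du s)) + dx (Fin.last T) ⬝ᵥ (S.HxxT *ᵥ dx (Fin.last T))
      = z ⬝ᵥ (P *ᵥ z)

/-- The trajectory supplied by `h` is zero before `t.succ`, so overwriting the state and the input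
at `t` changes only the stage cost at `t`, which was zero. -/
theorem CostToGo.cons {t : Fin T} {P : Matrix (Fin n) (Fin n) ℝ} (h : S.CostToGo t.succ P)
    (z : Fin n → ℝ) (v : Fin m → ℝ) :
    ∃ (dx : Fin (T + 1) → Fin n → ℝ) (du : Fin T → Fin m → ℝ),
    (∀ s < t.castSucc, dx s = 0) ∧ (∀ s : Fin T, s.castSucc < t.castSucc → du s = 0) ∧
    dx t.castSucc = z ∧ du t = v ∧
    (∀ s : Fin T, t.castSucc ≤ s.castSucc →
      dx s.succ = S.F s *ᵥ dx s.castSucc + S.G s *ᵥ du s) ∧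
    (∑ s, S.stage s (dx s.castSucc) (du s)) + dx (Fin.last T) ⬝ᵥ (S.HxxT *ᵥ dx (Fin.last T))
      = S.stage t z v + (S.F t *ᵥ z + S.G t *ᵥ v) ⬝ᵥ (P *ᵥ (S.F t *ᵥ z + S.G t *ᵥ v)) := by
  obtain ⟨dx, du, h1, h2, h3, h4, h5⟩ := h (S.F t *ᵥ z + S.G t *ᵥ v)
  have hne : ∀ s : Fin (T + 1), t.succ ≤ s → s ≠ t.castSucc := by
    rintro s hs rfl
    exact absurd hs (not_le.2 t.castSucc_lt_succ)
  have hdx : ∀ s : Fin (T + 1), s ≠ t.castSucc →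
      Function.update dx t.castSucc z s = dx s := fun s hs => Function.update_of_ne hs _ _
  have hdu : ∀ s : Fin T, s ≠ t → Function.update du t v s = du s :=
    fun s hs => Function.update_of_ne hs _ _
  refine ⟨Function.update dx t.castSucc z, Function.update du t v, ?_, ?_,
    Function.update_self .., Function.update_self .., ?_, ?_⟩
  · intro s hs
    rw [hdx s hs.ne]
    exact h1 s (hs.trans t.castSucc_lt_succ)
  · intro s hs
    rw [hdu s (by rintro rfl; exact lt_irrefl _ hs)]
    exact h2 s (hs.trans t.castSucc_lt_succ)
  · intro s hs
    rcases eq_or_lt_of_le (Fin.castSucc_le_castSucc_iff.1 hs) with rfl | hlt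
    · rw [hdx _ (hne _ le_rfl), h3, Function.update_self, Function.update_self]
    · have hle : t.succ ≤ s.castSucc := Fin.succ_le_castSucc_iff.2 hlt
      rw [hdx _ (hne _ hle), hdx _ (hne _ (hle.trans s.castSucc_lt_succ.le)), hdu s hlt.ne']
      exact h4 s hle
  · rw [← h5, hdx _ (hne _ (Fin.le_last _)), ← add_assoc]
    congr 1
    rw [← Finset.add_sum_erase _ _ (Finset.mem_univ t),
      ← Finset.add_sum_erase (a := t) _ (fun s => S.stage s (dx s.castSucc) (du s))
        (Finset.mem_univ t),
      Function.update_self, Function.update_self, h1 _ t.castSucc_lt_succ,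
      h2 _ t.castSucc_lt_succ, stage_zero, zero_add]
    congr 1
    refine Finset.sum_congr rfl fun s hs => ?_
    have hst := Finset.ne_of_mem_erase hs
    rw [hdx _ fun h => hst (Fin.castSucc_injective _ h), hdu s hst]

/-- Let `v + P R v = 0`. Applying `u = Huu⁻¹ Gᵀ v` at time `t` from the zero state and continuing
with the cost-to-go costs `(G u) ⬝ᵥ (v + P G u) = 0`. Positivity of the second variation gives `u =
0`, and therefore `v = 0`. -/
theorem CostToGo.isUnit (hpos : S.SecondVariationPos) {t : Fin T}
    {P : Matrix (Fin n) (Fin n) ℝ} (h : S.CostToGo t.succ P) (huu : IsUnit (S.Huu t)) :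
    IsUnit (1 + P * S.R t) := by
  rw [← Matrix.mulVec_injective_iff_isUnit, ← Matrix.coe_mulVecLin,
    ← LinearMap.ker_eq_bot, LinearMap.ker_eq_bot']
  intro v hv
  rw [Matrix.mulVecLin_apply, Matrix.add_mulVec, Matrix.one_mulVec, ← Matrix.mulVec_mulVec] at hv
  set u : Fin m → ℝ := (S.Huu t)⁻¹ *ᵥ ((S.G t)ᵀ *ᵥ v) with hu
  have hR : S.R t *ᵥ v = S.G t *ᵥ u := by
    rw [hu, R, ← Matrix.mulVec_mulVec, ← Matrix.mulVec_mulVec]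
  rw [hR] at hv
  have hHu : S.Huu t *ᵥ u = (S.G t)ᵀ *ᵥ v := by
    rw [hu, Matrix.mulVec_mulVec, Matrix.mul_nonsing_inv _ ((Matrix.isUnit_iff_isUnit_det _).1 huu),
      Matrix.one_mulVec]
  obtain ⟨dx, du, h1, h2, h3, h4, h5, h6⟩ := h.cons 0 u
  have hcost : S.stage t 0 u
      + (S.F t *ᵥ 0 + S.G t *ᵥ u) ⬝ᵥ (P *ᵥ (S.F t *ᵥ 0 + S.G t *ᵥ u)) = 0 := by
    rw [stage_eq, Matrix.mulVec_zero (S.Hux t), Matrix.mulVec_zero (S.F t), zero_add, hHu,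
      zero_dotProduct, zero_add, zero_add, Matrix.mulVec_transpose, dotProduct_comm u,
      ← Matrix.dotProduct_mulVec,
      dotProduct_comm, ← dotProduct_add, hv, dotProduct_zero]
  by_cases hz : (dx, du) = 0
  · have : u = 0 := by rw [← h4, (Prod.mk_eq_zero.1 hz).2]; rfl
    rw [this] at hv
    simpa using hv
  · refine absurd (h6.trans hcost) (hpos dx du ?_ ?_ hz).ne'
    · rcases eq_or_lt_of_le (Fin.zero_le t.castSucc) with h0 | h0
      · rw [h0, h3]
      · exact h1 _ h0
    · intro s
      rcases le_or_gt t.castSucc s.castSucc with hs | hs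
      · exact h5 s hs
      · rw [h1 _ hs, h2 _ hs, Matrix.mulVec_zero, Matrix.mulVec_zero, add_zero]
        rcases eq_or_lt_of_le (Fin.succ_le_castSucc_iff.2 (Fin.castSucc_lt_castSucc_iff.1 hs))
          with h0 | h0
        · rw [h0, h3]
        · exact h1 _ h0

/-- The recursion's feedback input is used. With `y` the resulting costate at `t + 1`, the input
equation and `y = P x_{t+1}` reduce the cost to `z ⬝ᵥ (Hxx z + Hxu v + Fᵀ y)`, which is the Riccati
form. Neither minimality of this input nor symmetry of `P` is needed. -/
theorem costToGo_castSucc (hS : S.IsSymm) {t : Fin T} {P : Matrix (Fin n) (Fin n) ℝ}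
    (h : S.CostToGo t.succ P) (hU : IsUnit (1 + P * S.R t)) (huu : IsUnit (S.Huu t)) :
    S.CostToGo t.castSucc (S.Q t + (S.A t)ᵀ * (1 + P * S.R t)⁻¹ * P * S.A t) := by
  intro z
  -- Solution of `y = P (A z - R y)`, which is `P` applied to the next state.
  set y : Fin n → ℝ := (1 + P * S.R t)⁻¹ *ᵥ (P *ᵥ (S.A t *ᵥ z)) with hy
  set v : Fin m → ℝ := -((S.Huu t)⁻¹ *ᵥ (S.Hux t *ᵥ z + (S.G t)ᵀ *ᵥ y)) with hv
  obtain ⟨dx, du, h1, h2, h3, -, h5, h6⟩ := h.cons z v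
  refine ⟨dx, du, h1, h2, h3, h5, h6.trans ?_⟩
  have hHu : S.Hux t *ᵥ z + S.Huu t *ᵥ v = -((S.G t)ᵀ *ᵥ y) := by
    rw [hv, Matrix.mulVec_neg, Matrix.mulVec_mulVec,
      Matrix.mul_nonsing_inv _ ((Matrix.isUnit_iff_isUnit_det _).1 huu), Matrix.one_mulVec]
    abel
  have hGv : S.F t *ᵥ z + S.G t *ᵥ v = S.A t *ᵥ z - S.R t *ᵥ y := by
    simp only [hv, A, R, Matrix.sub_mulVec, Matrix.mulVec_neg, Matrix.mulVec_add,
      Matrix.mulVec_mulVec, Matrix.mul_assoc]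
    abel
  have hyP : P *ᵥ (S.F t *ᵥ z + S.G t *ᵥ v) = y := by
    have : (1 + P * S.R t) *ᵥ y = P *ᵥ (S.A t *ᵥ z) := by
      rw [hy, Matrix.mulVec_mulVec,
        Matrix.mul_nonsing_inv _ ((Matrix.isUnit_iff_isUnit_det _).1 hU), Matrix.one_mulVec]
    rw [Matrix.add_mulVec, Matrix.one_mulVec, ← Matrix.mulVec_mulVec] at this
    rw [hGv, Matrix.mulVec_sub, ← this]
    abel
  have hx : S.Hxx t *ᵥ z + S.Hxu t *ᵥ v + (S.F t)ᵀ *ᵥ y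
      = (S.Q t + (S.A t)ᵀ * (1 + P * S.R t)⁻¹ * P * S.A t) *ᵥ z := by
    have : ((S.A t)ᵀ * (1 + P * S.R t)⁻¹ * P * S.A t) *ᵥ z = (S.A t)ᵀ *ᵥ y := by
      simp only [hy, Matrix.mulVec_mulVec, Matrix.mul_assoc]
    rw [Matrix.add_mulVec, this, hS.transpose_A]
    simp only [hv, Q, Matrix.sub_mulVec, Matrix.mulVec_neg, Matrix.mulVec_add,
      Matrix.mulVec_mulVec, Matrix.mul_assoc]
    abel
  rw [hyP, stage_eq, hHu, ← hx, dotProduct_add z (_ + _), add_dotProduct, Matrix.mulVec_transpose,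
    Matrix.mulVec_transpose, dotProduct_neg, dotProduct_comm v, dotProduct_comm z (y ᵥ* S.F t),
    ← Matrix.dotProduct_mulVec, ← Matrix.dotProduct_mulVec, dotProduct_comm y, dotProduct_comm y]
  ring

theorem costToGo_riccati (hS : S.IsSymm) (hpos : S.SecondVariationPos)
    (huu : ∀ t, IsUnit (S.Huu t)) (t : Fin (T + 1)) : S.CostToGo t (S.riccati t).1 := by
  induction t using Fin.reverseInduction with
  | last =>
    intro z
    refine ⟨fun s => if s = Fin.last T then z else 0, 0, ?_, ?_, ?_, ?_, ?_⟩
    · intro s hs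
      simp [hs.ne]
    · intro s _
      rfl
    · simp
    · intro s hs
      exact absurd hs (not_le.2 s.castSucc_lt_last)
    · simp [riccati_last, (Fin.castSucc_lt_last _).ne]
  | cast t ih =>
    rw [riccati_castSucc]
    exact costToGo_castSucc hS ih (ih.isUnit hpos (huu t)) (huu t)

/-- Backward induction gives the affine relation `Y_t = P_t X_t + W_t`. Eliminating the next state
from it determines `Y_{t+1}` through the inverse of `I + P R`, so the input equation becomes the
feedback law. Forward induction then matches the states. -/
theorem IsKKT.eq_rec (hS : S.IsSymm) (hpos : S.SecondVariationPos)
    (huu : ∀ t, IsUnit (S.Huu t))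
    {X Y : Fin (T + 1) → Matrix (Fin n) (Fin r) ℝ} {U : Fin T → Matrix (Fin m) (Fin r) ℝ}
    (h : S.IsKKT X U Y) : S.recX = X ∧ S.recU = U := by
  have hU : ∀ t : Fin T, IsUnit (1 + (S.riccati t.succ).1 * S.R t) :=
    fun t => (costToGo_riccati hS hpos huu t.succ).isUnit hpos (huu t)
  have hin : ∀ t : Fin T, U t =
      -((S.Huu t)⁻¹ * (S.Hux t * X t.castSucc + S.Huθ t + (S.G t)ᵀ * Y t.succ)) := by
    intro t
    have h1 : S.Huu t * U t
        = -(S.Hux t * X t.castSucc + S.Huθ t + (S.G t)ᵀ * Y t.succ) := by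
      rw [eq_neg_iff_add_eq_zero, ← h.input t]
      abel
    rw [← Matrix.mul_neg, ← h1, ← Matrix.mul_assoc,
      Matrix.nonsing_inv_mul _ ((Matrix.isUnit_iff_isUnit_det _).1 (huu t)), Matrix.one_mul]
  have hnext : ∀ t : Fin T, Y t.succ
      = (S.riccati t.succ).1 * X t.succ + (S.riccati t.succ).2 →
      Y t.succ = (1 + (S.riccati t.succ).1 * S.R t)⁻¹ *
        ((S.riccati t.succ).1 * S.A t * X t.castSucc + (S.riccati t.succ).1 * S.M t
          + (S.riccati t.succ).2) := by
    intro t ht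
    have h1 : (1 + (S.riccati t.succ).1 * S.R t) * Y t.succ
        = (S.riccati t.succ).1 * S.A t * X t.castSucc + (S.riccati t.succ).1 * S.M t
          + (S.riccati t.succ).2 := by
      have h2 : X t.succ = S.A t * X t.castSucc + S.M t - S.R t * Y t.succ := by
        rw [h.feasible.2 t, hin t]
        simp only [A, M, R, Matrix.sub_mul, Matrix.mul_neg, Matrix.mul_add, Matrix.mul_assoc]
        abel
      rw [Matrix.add_mul, Matrix.one_mul]
      nth_rewrite 1 [ht]
      rw [h2]
      simp only [Matrix.mul_sub, Matrix.mul_add, Matrix.mul_assoc]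
      abel
    rw [← h1, ← Matrix.mul_assoc,
      Matrix.nonsing_inv_mul _ ((Matrix.isUnit_iff_isUnit_det _).1 (hU t)), Matrix.one_mul]
  have hY : ∀ t, Y t = (S.riccati t).1 * X t + (S.riccati t).2 := by
    intro t
    induction t using Fin.reverseInduction with
    | last => rw [riccati_last, h.final]
    | cast t ih =>
      have h1 : Y t.castSucc = S.Q t * X t.castSucc + S.N t + (S.A t)ᵀ * Y t.succ := by
        rw [h.costate t, hin t, hS.transpose_A]
        simp only [Q, N, Matrix.sub_mul, Matrix.mul_neg, Matrix.mul_add, Matrix.mul_assoc]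
        abel
      rw [h1, hnext t ih, riccati_castSucc]
      simp only [Matrix.mul_add, Matrix.add_mul, Matrix.mul_assoc]
      abel
  have hrec : ∀ t : Fin T, S.recInput t (X t.castSucc) = U t := by
    intro t
    rw [hin t, recInput, hnext t (hY _), Matrix.mul_assoc (S.G t)ᵀ]
  have hX : ∀ t, S.recX t = X t := by
    intro t
    induction t using Fin.induction with
    | zero =>
      rw [h.feasible.1]
      rfl
    | succ t ih =>
      have h1 : S.recX t.succ = S.F t * S.recX t.castSucc
          + S.G t * S.recInput t (S.recX t.castSucc) + S.E t := by
        simp only [recX, Fin.induction_succ]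
      rw [h1, ih, hrec, h.feasible.2 t]
  exact ⟨funext hX, funext fun t => by rw [recU, hX, hrec]⟩

theorem IsKKT.eq_of_isOutput (hS : S.IsSymm) (hpos : S.SecondVariationPos)
    {X Y X' : Fin (T + 1) → Matrix (Fin n) (Fin r) ℝ} {U U' : Fin T → Matrix (Fin m) (Fin r) ℝ}
    (h : S.IsKKT X U Y) (h' : S.IsOutput X' U') : X' = X ∧ U' = U := by
  rcases h' with h' | ⟨huu, rfl, rfl⟩
  · exact h.eq_of_isStationary hS hpos h'
  · exact h.eq_rec hS hpos huu

end LQR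

/-! ### Jacobian matrices and Fréchet derivatives -/

theorem jacobian_apply_of_hasFDerivAt {p q : ℕ} {g : Vec p → Vec q} {z : Vec p}
    {D : Fin q → (Vec p →L[ℝ] ℝ)} (h : ∀ a, HasFDerivAt (fun y => g y a) (D a) z)
    (a : Fin q) (b : Fin p) : jacobian g z a b = D a (EuclideanSpace.single b 1) := by
  have hg : DifferentiableAt ℝ g z := differentiableAt_euclidean.2 fun i => (h i).differentiableAt
  have h1 := ((EuclideanSpace.proj (𝕜 := ℝ) a).hasFDerivAt.comp z hg.hasFDerivAt).unique (h a)
  rw [← h1]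
  rfl

theorem sum_apply_single_mul {p : ℕ} (φ : Vec p →L[ℝ] ℝ) (v : Vec p) :
    ∑ c, φ (EuclideanSpace.single c 1) * v c = φ v := by
  conv_rhs => rw [← (EuclideanSpace.basisFun (Fin p) ℝ).sum_repr v]
  simp [mul_comm]

theorem mul_jacobian_apply {p q : ℕ} {ι : Type*} {M : Matrix ι (Fin p) ℝ}
    {φ : ι → (Vec p →L[ℝ] ℝ)} (hM : ∀ a c, M a c = φ a (EuclideanSpace.single c 1))
    (g : Vec q → Vec p) (z : Vec q) (a : ι) (b : Fin q) :
    (M * jacobian g z) a b = φ a (fderiv ℝ g z (EuclideanSpace.single b 1)) := by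
  rw [Matrix.mul_apply, ← sum_apply_single_mul]
  simp only [hM]
  rfl

theorem transpose_mul_jacobian_apply {p q : ℕ} {ι : Type*} {M : Matrix (Fin p) ι ℝ}
    {w : ι → Vec p} (hM : ∀ c a, M c a = w a c)
    (g : Vec q → Vec p) (z : Vec q) (a : ι) (b : Fin q) :
    (Mᵀ * jacobian g z) a b = inner ℝ (w a) (fderiv ℝ g z (EuclideanSpace.single b 1)) := by
  rw [Matrix.mul_apply, PiLp.inner_apply]
  simp only [Matrix.transpose_apply, hM]
  refine Finset.sum_congr rfl fun c _ => ?_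
  simp [jacobian, mul_comm]

/-! ### Derivatives of the Hamiltonian -/

namespace OCSystem

variable {n m r T : ℕ} (S : OCSystem n m r T)

/-- The derivative of the Hamiltonian at `p` in the direction `v`. -/
noncomputable def dH (t : Fin T) (p : Vec n × Vec m × Vec r) (l : Vec n)
    (v : Vec n × Vec m × Vec r) : ℝ :=
  fderiv ℝ (S.c t) p v + inner ℝ (fderiv ℝ S.f p v) l

/-- The second derivative of the Hamiltonian at `p`, with the multiplier held fixed. -/
noncomputable def hessH (t : Fin T) (p : Vec n × Vec m × Vec r) (l : Vec n)
    (d v : Vec n × Vec m × Vec r) : ℝ :=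
  fderiv ℝ (fderiv ℝ (S.c t)) p d v + inner ℝ (fderiv ℝ (fderiv ℝ S.f) p d v) l

variable {S}

theorem dH_add (t : Fin T) (p l v w) : S.dH t p l (v + w) = S.dH t p l v + S.dH t p l w := by
  simp only [dH, map_add, inner_add_left]
  ring

theorem hessH_add (t : Fin T) (p l d d' v) :
    S.hessH t p l (d + d') v = S.hessH t p l d v + S.hessH t p l d' v := by
  simp only [hessH, map_add, inner_add_left, add_apply]
  ring

theorem Smooth.hessH_comm (hS : S.Smooth) (t : Fin T) (p l d v) :
    S.hessH t p l d v = S.hessH t p l v d := by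
  have h1 := second_derivative_symmetric (fun y => (hS.1.1 y).hasFDerivAt)
    (hS.1.2 p).hasFDerivAt d v
  have h2 := second_derivative_symmetric (fun y => ((hS.2.1 t).1 y).hasFDerivAt)
    ((hS.2.1 t).2 p).hasFDerivAt d v
  rw [hessH, hessH, h1, h2]

/-- `hessH` as a continuous linear map in the first argument. -/
noncomputable def hessHL (S : OCSystem n m r T) (t : Fin T) (p : Vec n × Vec m × Vec r) (l : Vec n)
    (v : Vec n × Vec m × Vec r) : (Vec n × Vec m × Vec r) →L[ℝ] ℝ :=
  (fderiv ℝ (fderiv ℝ (S.c t)) p).flip v + (innerSL ℝ l).comp ((fderiv ℝ (fderiv ℝ S.f) p).flip v)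

@[simp] theorem hessHL_apply (t : Fin T) (p l v d) : S.hessHL t p l v d = S.hessH t p l d v := by
  simp [hessHL, hessH, real_inner_comm]

section Derivatives

variable {E : Type*} [NormedAddCommGroup E] [NormedSpace ℝ E]

theorem Smooth.hasFDerivAt_hamiltonian (hS : S.Smooth) (t : Fin T)
    {p : E → Vec n × Vec m × Vec r} {p' : E →L[ℝ] Vec n × Vec m × Vec r} {z : E}
    (hp : HasFDerivAt p p' z) (l : Vec n) :
    ∃ D : E →L[ℝ] ℝ, HasFDerivAt (fun y => S.c t (p y) + inner ℝ (S.f (p y)) l) D z ∧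
      ∀ d, D d = S.dH t (p z) l (p' d) := by
  have h1 := (((hS.2.1 t).1 (p z)).hasFDerivAt.comp z hp).add
    ((innerSL ℝ l).hasFDerivAt.comp z ((hS.1.1 (p z)).hasFDerivAt.comp z hp))
  refine ⟨_, h1.congr_of_eventuallyEq (Filter.Eventually.of_forall fun y => ?_), fun d => ?_⟩
  · simp [real_inner_comm]
  · simp [dH, real_inner_comm]

/-- The multiplier is allowed to vary here; the resulting extra inner product is what becomes `Fᵀ Y`
or `Gᵀ Y` in the optimality system of the generator. -/
theorem Smooth.hasFDerivAt_dH (hS : S.Smooth) (t : Fin T)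
    {p : E → Vec n × Vec m × Vec r} {p' : E →L[ℝ] Vec n × Vec m × Vec r} {z : E}
    (hp : HasFDerivAt p p' z) {l : E → Vec n} {l' : E →L[ℝ] Vec n} (hl : HasFDerivAt l l' z)
    (v : Vec n × Vec m × Vec r) :
    ∃ D : E →L[ℝ] ℝ, HasFDerivAt (fun y => S.dH t (p y) (l y) v) D z ∧
      ∀ d, D d = S.hessH t (p z) (l z) (p' d) v + inner ℝ (fderiv ℝ S.f (p z) v) (l' d) := by
  have hc := (((hS.2.1 t).2 (p z)).hasFDerivAt.comp z hp).clm_apply (hasFDerivAt_const v z)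
  have hf := ((hS.1.2 (p z)).hasFDerivAt.comp z hp).clm_apply (hasFDerivAt_const v z)
  refine ⟨_, hc.add (hf.inner ℝ hl), fun d => ?_⟩
  simp [hessH]
  ring

end Derivatives

theorem hasFDerivAt_state (x : Vec n) (u : Vec m) (θ : Vec r) :
    HasFDerivAt (fun y => (y, u, θ)) (ContinuousLinearMap.inl ℝ (Vec n) (Vec m × Vec r)) x :=
  hasFDerivAt_prodMk_left x (u, θ)

theorem hasFDerivAt_input (x : Vec n) (u : Vec m) (θ : Vec r) :
    HasFDerivAt (fun y => (x, y, θ)) ((ContinuousLinearMap.inr ℝ (Vec n) (Vec m × Vec r)).comp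
      (ContinuousLinearMap.inl ℝ (Vec m) (Vec r))) u :=
  (hasFDerivAt_prodMk_right x (u, θ)).comp u (hasFDerivAt_prodMk_left u θ)

theorem hasFDerivAt_parameter (x : Vec n) (u : Vec m) (θ : Vec r) :
    HasFDerivAt (fun y => (x, u, y)) ((ContinuousLinearMap.inr ℝ (Vec n) (Vec m × Vec r)).comp
      (ContinuousLinearMap.inr ℝ (Vec m) (Vec r))) θ :=
  (hasFDerivAt_prodMk_right x (u, θ)).comp θ (hasFDerivAt_prodMk_right u θ)

theorem Smooth.inner_gradHx (hS : S.Smooth) (t : Fin T) (x u θ l v) :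
    inner ℝ (S.gradHx t x u θ l) v = S.dH t (x, u, θ) l (v, 0, 0) := by
  obtain ⟨D, hD, hd⟩ := hS.hasFDerivAt_hamiltonian t (hasFDerivAt_state x u θ) l
  rw [gradHx, gradient, InnerProductSpace.toDual_symm_apply]
  exact (congrArg (fun A : Vec n →L[ℝ] ℝ => A v) hD.fderiv).trans (hd v)

theorem Smooth.inner_gradHu (hS : S.Smooth) (t : Fin T) (x u θ l v) :
    inner ℝ (S.gradHu t x u θ l) v = S.dH t (x, u, θ) l (0, v, 0) := by
  obtain ⟨D, hD, hd⟩ := hS.hasFDerivAt_hamiltonian t (hasFDerivAt_input x u θ) l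
  rw [gradHu, gradient, InnerProductSpace.toDual_symm_apply]
  exact (congrArg (fun A : Vec m →L[ℝ] ℝ => A v) hD.fderiv).trans (by simp [hd])

theorem Smooth.inner_gradhx (hS : S.Smooth) (x θ v) :
    inner ℝ (S.gradhx x θ) v = fderiv ℝ S.h (x, θ) (v, 0) := by
  have hD := (hS.2.2.1 (x, θ)).hasFDerivAt.comp x (hasFDerivAt_prodMk_left (𝕜 := ℝ) x θ)
  rw [gradhx, gradient, InnerProductSpace.toDual_symm_apply]
  exact (congrArg (fun A : Vec n →L[ℝ] ℝ => A v) hD.fderiv).trans (by simp)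

theorem apply_eq_inner_single {p : ℕ} (v : Vec p) (a : Fin p) :
    v a = inner ℝ v (EuclideanSpace.single a 1) := by
  simp [EuclideanSpace.inner_single_right]

/-! ### The multipliers and the first-order condition -/

theorem multiplier_last (θ : Vec r) (ξ : Traj n m T) :
    S.multiplier θ ξ (Fin.last T) = S.gradhx (ξ.1 (Fin.last T)) θ := by
  rw [multiplier, Fin.reverseInduction_last]

theorem multiplier_castSucc (θ : Vec r) (ξ : Traj n m T) (t : Fin T) :
    S.multiplier θ ξ t.castSucc
      = S.gradHx t (ξ.1 t.castSucc) (ξ.2 t) θ (S.multiplier θ ξ t.succ) := by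
  rw [multiplier, Fin.reverseInduction_castSucc]

variable (S) in
/-- The states generated by the inputs `u`. -/
noncomputable def simulate (θ : Vec r) (u : Fin T → Vec m) : Fin (T + 1) → Vec n :=
  Fin.induction (motive := fun _ => Vec n) S.x0 (fun t x => S.f (x, u t, θ))

theorem simulate_succ (θ : Vec r) (u : Fin T → Vec m) (t : Fin T) :
    S.simulate θ u t.succ = S.f (S.simulate θ u t.castSucc, u t, θ) := by
  simp only [simulate, Fin.induction_succ]

theorem Feasible.simulate_eq {θ : Vec r} {ξ : Traj n m T} (h : S.Feasible θ ξ) :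
    S.simulate θ ξ.2 = ξ.1 := by
  funext t
  induction t using Fin.induction with
  | zero =>
    rw [h.1]
    rfl
  | succ t ih => rw [simulate_succ, ih, h.2]

theorem Smooth.hasDerivAt_simulate (hS : S.Smooth) (θ : Vec r) (u du : Fin T → Vec m) :
    ∃ dx : Fin (T + 1) → Vec n, dx 0 = 0 ∧
      (∀ t : Fin T, dx t.succ =
        fderiv ℝ S.f (S.simulate θ u t.castSucc, u t, θ) (dx t.castSucc, du t, 0)) ∧
      ∀ t, HasDerivAt (fun s : ℝ => S.simulate θ (u + s • du) t) (dx t) 0 := by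
  set dx : Fin (T + 1) → Vec n := Fin.induction (motive := fun _ => Vec n) 0
    (fun t y => fderiv ℝ S.f (S.simulate θ u t.castSucc, u t, θ) (y, du t, 0)) with hdx
  have hsucc : ∀ t : Fin T, dx t.succ =
      fderiv ℝ S.f (S.simulate θ u t.castSucc, u t, θ) (dx t.castSucc, du t, 0) := fun t => by
    simp only [hdx, Fin.induction_succ]
  refine ⟨dx, rfl, hsucc, fun t => ?_⟩
  induction t using Fin.induction with
  | zero => exact hasDerivAt_const (0 : ℝ) S.x0
  | succ t ih =>
    simp only [simulate_succ, hsucc]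
    have hu : HasDerivAt (fun s : ℝ => (u + s • du) t) (du t) 0 := by
      simpa using ((hasDerivAt_id (0 : ℝ)).smul_const (du t)).const_add (u t)
    have hp := ih.prodMk (hu.prodMk (hasDerivAt_const (0 : ℝ) θ))
    refine HasFDerivAt.comp_hasDerivAt (f := fun s : ℝ =>
      (S.simulate θ (u + s • du) t.castSucc, (u + s • du) t, θ)) (0 : ℝ) ?_ hp
    simpa using (hS.1.1 (S.simulate θ u t.castSucc, u t, θ)).hasFDerivAt

/-- Simulating the dynamics eliminates the states, so `s = 0` is an unconstrained minimum along `u +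
s • du`. In the derivative of the objective the state sensitivities are absorbed by the multipliers
in a telescoping sum. -/
theorem IsOptimal.sum_dH_input (hS : S.Smooth) {θ : Vec r} {ξ : Traj n m T}
    (h : S.IsOptimal θ ξ) (du : Fin T → Vec m) :
    ∑ t : Fin T, S.dH t (ξ.1 t.castSucc, ξ.2 t, θ) (S.multiplier θ ξ t.succ) (0, du t, 0) = 0 := by
  obtain ⟨dx, h0, hdx, hder⟩ := hS.hasDerivAt_simulate θ ξ.2 du
  rw [h.1.simulate_eq] at hdx
  have hJ : HasDerivAt (fun s : ℝ => S.J θ (S.simulate θ (ξ.2 + s • du), ξ.2 + s • du))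
      ((∑ t : Fin T, fderiv ℝ (S.c t) (ξ.1 t.castSucc, ξ.2 t, θ) (dx t.castSucc, du t, 0))
        + fderiv ℝ S.h (ξ.1 (Fin.last T), θ) (dx (Fin.last T), 0)) 0 := by
    unfold J
    refine HasDerivAt.add (HasDerivAt.fun_sum fun t _ => ?_) ?_
    · have hu : HasDerivAt (fun s : ℝ => (ξ.2 + s • du) t) (du t) 0 := by
        simpa using ((hasDerivAt_id (0 : ℝ)).smul_const (du t)).const_add (ξ.2 t)
      refine HasFDerivAt.comp_hasDerivAt (f := fun s : ℝ =>
        (S.simulate θ (ξ.2 + s • du) t.castSucc, (ξ.2 + s • du) t, θ)) (0 : ℝ) ?_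
        ((hder _).prodMk (hu.prodMk (hasDerivAt_const (0 : ℝ) θ)))
      simpa [h.1.simulate_eq] using ((hS.2.1 t).1 (ξ.1 t.castSucc, ξ.2 t, θ)).hasFDerivAt
    · refine HasFDerivAt.comp_hasDerivAt (f := fun s : ℝ =>
        (S.simulate θ (ξ.2 + s • du) (Fin.last T), θ)) (0 : ℝ) ?_
        ((hder _).prodMk (hasDerivAt_const (0 : ℝ) θ))
      simpa [h.1.simulate_eq] using (hS.2.2.1 (ξ.1 (Fin.last T), θ)).hasFDerivAt
  have hmin : IsLocalMin (fun s : ℝ => S.J θ (S.simulate θ (ξ.2 + s • du), ξ.2 + s • du)) 0 := by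
    refine Filter.Eventually.of_forall fun s => ?_
    have e : (S.simulate θ (ξ.2 + (0 : ℝ) • du), ξ.2 + (0 : ℝ) • du) = ξ := by
      simp [h.1.simulate_eq]
    beta_reduce
    rw [e]
    exact h.2 _ ⟨rfl, fun t => simulate_succ θ _ t⟩
  have hz := hmin.hasDerivAt_eq_zero hJ
  rw [← hS.inner_gradhx, ← multiplier_last] at hz
  have hstep : ∀ t : Fin T,
      fderiv ℝ (S.c t) (ξ.1 t.castSucc, ξ.2 t, θ) (dx t.castSucc, du t, 0)
      = S.dH t (ξ.1 t.castSucc, ξ.2 t, θ) (S.multiplier θ ξ t.succ) (0, du t, 0)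
        - (inner ℝ (S.multiplier θ ξ t.succ) (dx t.succ)
          - inner ℝ (S.multiplier θ ξ t.castSucc) (dx t.castSucc)) := by
    intro t
    have e : ((dx t.castSucc, du t, 0) : Vec n × Vec m × Vec r)
        = (dx t.castSucc, 0, 0) + (0, du t, 0) := by simp
    have h1 := dH_add (S := S) t (ξ.1 t.castSucc, ξ.2 t, θ) (S.multiplier θ ξ t.succ)
      (dx t.castSucc, 0, 0) (0, du t, 0)
    rw [← e, dH, ← hdx, ← hS.inner_gradHx, ← multiplier_castSucc, real_inner_comm] at h1
    linarith
  rw [Finset.sum_congr rfl fun t _ => hstep t, Finset.sum_sub_distrib,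
    LQR.sum_succ_sub_castSucc fun t => inner ℝ (S.multiplier θ ξ t) (dx t), h0,
    inner_zero_right] at hz
  linarith

theorem IsOptimal.dH_input_eq_zero (hS : S.Smooth) {θ : Vec r} {ξ : Traj n m T}
    (h : S.IsOptimal θ ξ) (t : Fin T) (v : Vec m) :
    S.dH t (ξ.1 t.castSucc, ξ.2 t, θ) (S.multiplier θ ξ t.succ) (0, v, 0) = 0 := by
  have h1 := h.sum_dH_input hS (Pi.single t v)
  rw [Finset.sum_eq_single t] at h1
  · simpa using h1
  · intro s _ hs
    rw [Pi.single_eq_of_ne hs]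
    change S.dH s _ _ 0 = 0
    simp [dH]
  · simp

theorem Smooth.gradHx_apply (hS : S.Smooth) (t : Fin T) (x u θ l a) :
    S.gradHx t x u θ l a = S.dH t (x, u, θ) l (EuclideanSpace.single a 1, 0, 0) := by
  rw [apply_eq_inner_single, hS.inner_gradHx]

theorem Smooth.gradHu_apply (hS : S.Smooth) (t : Fin T) (x u θ l a) :
    S.gradHu t x u θ l a = S.dH t (x, u, θ) l (0, EuclideanSpace.single a 1, 0) := by
  rw [apply_eq_inner_single, hS.inner_gradHu]

theorem Smooth.gradhx_apply (hS : S.Smooth) (x θ a) :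
    S.gradhx x θ a = fderiv ℝ S.h (x, θ) (EuclideanSpace.single a 1, 0) := by
  rw [apply_eq_inner_single, hS.inner_gradhx]

theorem Smooth.jacobian_eq_hessH (hS : S.Smooth) (t : Fin T) {p q : ℕ} {g : Vec p → Vec q}
    {y : Vec p → Vec n × Vec m × Vec r} {y' : Vec p →L[ℝ] Vec n × Vec m × Vec r} {z : Vec p}
    (hy : HasFDerivAt y y' z) (l : Vec n) (v : Fin q → Vec n × Vec m × Vec r)
    (hg : ∀ x a, g x a = S.dH t (y x) l (v a)) (a : Fin q) (b : Fin p) :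
    jacobian g z a b = S.hessH t (y z) l (y' (EuclideanSpace.single b 1)) (v a) := by
  choose D hD hd using fun a => hS.hasFDerivAt_dH t hy (hasFDerivAt_const l z) (v a)
  rw [jacobian_apply_of_hasFDerivAt (D := D) (fun a => by simpa only [hg] using hD a), hd]
  simp

theorem Smooth.hasFDerivAt_fderiv_h (hS : S.Smooth) {E : Type*} [NormedAddCommGroup E]
    [NormedSpace ℝ E] {y : E → Vec n × Vec r} {y' : E →L[ℝ] Vec n × Vec r} {z : E}
    (hy : HasFDerivAt y y' z) (v : Vec n × Vec r) :
    HasFDerivAt (fun x => fderiv ℝ S.h (y x) v)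
      (((fderiv ℝ (fderiv ℝ S.h) (y z)).flip v).comp y') z := by
  have h1 := ((hS.2.2.2 (y z)).hasFDerivAt.comp z hy).clm_apply (hasFDerivAt_const v z)
  refine h1.congr_fderiv ?_
  ext d
  simp

theorem Smooth.jacobian_eq_hess_h (hS : S.Smooth) {p q : ℕ} {g : Vec p → Vec q}
    {y : Vec p → Vec n × Vec r} {y' : Vec p →L[ℝ] Vec n × Vec r} {z : Vec p}
    (hy : HasFDerivAt y y' z) (v : Fin q → Vec n × Vec r)
    (hg : ∀ x a, g x a = fderiv ℝ S.h (y x) (v a)) (a : Fin q) (b : Fin p) :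
    jacobian g z a b
      = fderiv ℝ (fderiv ℝ S.h) (y z) (y' (EuclideanSpace.single b 1)) (v a) := by
  rw [jacobian_apply_of_hasFDerivAt
    (D := fun a => ((fderiv ℝ (fderiv ℝ S.h) (y z)).flip (v a)).comp y')
    (fun a => by simpa only [hg] using hS.hasFDerivAt_fderiv_h hy (v a))]
  simp

/-! ### The entries of the gradient generator -/

section Entries

variable (hS : S.Smooth) (θ : Vec r) (ξ : Traj n m T) (t : Fin T)
include hS

theorem Smooth.generator_F (a c) : (S.gradientGenerator θ ξ).F t a c =
    fderiv ℝ S.f (ξ.1 t.castSucc, ξ.2 t, θ) (EuclideanSpace.single c 1, 0, 0) a := by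
  have h := (hS.1.1 (ξ.1 t.castSucc, ξ.2 t, θ)).hasFDerivAt.comp (f := fun y => (y, ξ.2 t, θ)) (ξ.1 t.castSucc)
    (hasFDerivAt_state (ξ.1 t.castSucc) (ξ.2 t) θ)
  change fderiv ℝ (S.f ∘ fun y => (y, ξ.2 t, θ)) _ _ a = _
  rw [h.fderiv]
  rfl

theorem Smooth.generator_G (a c) : (S.gradientGenerator θ ξ).G t a c =
    fderiv ℝ S.f (ξ.1 t.castSucc, ξ.2 t, θ) (0, EuclideanSpace.single c 1, 0) a := by
  have h := (hS.1.1 (ξ.1 t.castSucc, ξ.2 t, θ)).hasFDerivAt.comp (f := fun y => (ξ.1 t.castSucc, y, θ)) (ξ.2 t)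
    (hasFDerivAt_input (ξ.1 t.castSucc) (ξ.2 t) θ)
  change fderiv ℝ (S.f ∘ fun y => (ξ.1 t.castSucc, y, θ)) _ _ a = _
  rw [h.fderiv]
  rfl

theorem Smooth.generator_E (a c) : (S.gradientGenerator θ ξ).E t a c =
    fderiv ℝ S.f (ξ.1 t.castSucc, ξ.2 t, θ) (0, 0, EuclideanSpace.single c 1) a := by
  have h := (hS.1.1 (ξ.1 t.castSucc, ξ.2 t, θ)).hasFDerivAt.comp (f := fun y => (ξ.1 t.castSucc, ξ.2 t, y)) θ
    (hasFDerivAt_parameter (ξ.1 t.castSucc) (ξ.2 t) θ)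
  change fderiv ℝ (S.f ∘ fun y => (ξ.1 t.castSucc, ξ.2 t, y)) _ _ a = _
  rw [h.fderiv]
  rfl

theorem Smooth.generator_Hxx (a c) : (S.gradientGenerator θ ξ).Hxx t a c =
    S.hessH t (ξ.1 t.castSucc, ξ.2 t, θ) (S.multiplier θ ξ t.succ)
      (EuclideanSpace.single c 1, 0, 0) (EuclideanSpace.single a 1, 0, 0) :=
  hS.jacobian_eq_hessH t (hasFDerivAt_state _ _ _) _
    (fun a => (EuclideanSpace.single a 1, 0, 0)) (fun _ _ => hS.gradHx_apply ..) a c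

theorem Smooth.generator_Hxu (a c) : (S.gradientGenerator θ ξ).Hxu t a c =
    S.hessH t (ξ.1 t.castSucc, ξ.2 t, θ) (S.multiplier θ ξ t.succ)
      (0, EuclideanSpace.single c 1, 0) (EuclideanSpace.single a 1, 0, 0) :=
  hS.jacobian_eq_hessH t (hasFDerivAt_input _ _ _) _
    (fun a => (EuclideanSpace.single a 1, 0, 0)) (fun _ _ => hS.gradHx_apply ..) a c

theorem Smooth.generator_Hxθ (a c) : (S.gradientGenerator θ ξ).Hxθ t a c =
    S.hessH t (ξ.1 t.castSucc, ξ.2 t, θ) (S.multiplier θ ξ t.succ)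
      (0, 0, EuclideanSpace.single c 1) (EuclideanSpace.single a 1, 0, 0) :=
  hS.jacobian_eq_hessH t (hasFDerivAt_parameter _ _ _) _
    (fun a => (EuclideanSpace.single a 1, 0, 0)) (fun _ _ => hS.gradHx_apply ..) a c

theorem Smooth.generator_Hux (a c) : (S.gradientGenerator θ ξ).Hux t a c =
    S.hessH t (ξ.1 t.castSucc, ξ.2 t, θ) (S.multiplier θ ξ t.succ)
      (EuclideanSpace.single c 1, 0, 0) (0, EuclideanSpace.single a 1, 0) :=
  hS.jacobian_eq_hessH t (hasFDerivAt_state _ _ _) _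
    (fun a => (0, EuclideanSpace.single a 1, 0)) (fun _ _ => hS.gradHu_apply ..) a c

theorem Smooth.generator_Huu (a c) : (S.gradientGenerator θ ξ).Huu t a c =
    S.hessH t (ξ.1 t.castSucc, ξ.2 t, θ) (S.multiplier θ ξ t.succ)
      (0, EuclideanSpace.single c 1, 0) (0, EuclideanSpace.single a 1, 0) :=
  hS.jacobian_eq_hessH t (hasFDerivAt_input _ _ _) _
    (fun a => (0, EuclideanSpace.single a 1, 0)) (fun _ _ => hS.gradHu_apply ..) a c

theorem Smooth.generator_Huθ (a c) : (S.gradientGenerator θ ξ).Huθ t a c =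
    S.hessH t (ξ.1 t.castSucc, ξ.2 t, θ) (S.multiplier θ ξ t.succ)
      (0, 0, EuclideanSpace.single c 1) (0, EuclideanSpace.single a 1, 0) :=
  hS.jacobian_eq_hessH t (hasFDerivAt_parameter _ _ _) _
    (fun a => (0, EuclideanSpace.single a 1, 0)) (fun _ _ => hS.gradHu_apply ..) a c

theorem Smooth.generator_HxxT (a c) : (S.gradientGenerator θ ξ).HxxT a c =
    fderiv ℝ (fderiv ℝ S.h) (ξ.1 (Fin.last T), θ)
      (EuclideanSpace.single c 1, 0) (EuclideanSpace.single a 1, 0) :=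
  hS.jacobian_eq_hess_h (hasFDerivAt_prodMk_left (𝕜 := ℝ) (ξ.1 (Fin.last T)) θ)
    (fun a => (EuclideanSpace.single a 1, 0)) (fun _ _ => hS.gradhx_apply ..) a c

theorem Smooth.generator_HxθT (a c) : (S.gradientGenerator θ ξ).HxθT a c =
    fderiv ℝ (fderiv ℝ S.h) (ξ.1 (Fin.last T), θ)
      (0, EuclideanSpace.single c 1) (EuclideanSpace.single a 1, 0) :=
  hS.jacobian_eq_hess_h (hasFDerivAt_prodMk_right (𝕜 := ℝ) (ξ.1 (Fin.last T)) θ)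
    (fun a => (EuclideanSpace.single a 1, 0)) (fun _ _ => hS.gradhx_apply ..) a c

end Entries

/-- Differentiability of the first derivative already makes second derivatives symmetric; their
continuity is not required. -/
theorem Smooth.isSymm_gradientGenerator (hS : S.Smooth) (θ : Vec r) (ξ : Traj n m T) :
    (S.gradientGenerator θ ξ).IsSymm where
  xx t := by
    ext a c
    rw [Matrix.transpose_apply, hS.generator_Hxx, hS.generator_Hxx, hS.hessH_comm]
  uu t := by
    ext a c
    rw [Matrix.transpose_apply, hS.generator_Huu, hS.generator_Huu, hS.hessH_comm]
  ux t := by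
    ext a c
    rw [Matrix.transpose_apply, hS.generator_Hux, hS.generator_Hxu, hS.hessH_comm]
  xxT := by
    ext a c
    rw [Matrix.transpose_apply, hS.generator_HxxT, hS.generator_HxxT]
    exact second_derivative_symmetric (fun y => (hS.2.2.1 y).hasFDerivAt)
      (hS.2.2.2 _).hasFDerivAt _ _

/-! ### Sensitivities of the optimal trajectory -/

section Sensitivity

variable {ξ : Vec r → Traj n m T} (hξ : Differentiable ℝ ξ)
include hξ

theorem hasFDerivAt_state_of_traj (t : Fin (T + 1)) (θ : Vec r) :
    HasFDerivAt (fun ϑ => (ξ ϑ).1 t) (fderiv ℝ (fun ϑ => (ξ ϑ).1 t) θ) θ :=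
  DifferentiableAt.hasFDerivAt (by fun_prop)

theorem hasFDerivAt_input_of_traj (t : Fin T) (θ : Vec r) :
    HasFDerivAt (fun ϑ => (ξ ϑ).2 t) (fderiv ℝ (fun ϑ => (ξ ϑ).2 t) θ) θ :=
  DifferentiableAt.hasFDerivAt (by fun_prop)

theorem hasFDerivAt_point_of_traj (t : Fin T) (θ : Vec r) :
    HasFDerivAt (fun ϑ => ((ξ ϑ).1 t.castSucc, (ξ ϑ).2 t, ϑ))
      ((fderiv ℝ (fun ϑ => (ξ ϑ).1 t.castSucc) θ).prod
        ((fderiv ℝ (fun ϑ => (ξ ϑ).2 t) θ).prod (ContinuousLinearMap.id ℝ (Vec r)))) θ :=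
  (hasFDerivAt_state_of_traj hξ _ θ).prodMk
    ((hasFDerivAt_input_of_traj hξ t θ).prodMk (hasFDerivAt_id θ))

theorem Smooth.differentiable_multiplier (hS : S.Smooth) (t : Fin (T + 1)) :
    Differentiable ℝ fun ϑ => S.multiplier ϑ (ξ ϑ) t := by
  induction t using Fin.reverseInduction with
  | last =>
    intro θ
    refine differentiableAt_euclidean.2 fun a => ?_
    simp only [multiplier_last, hS.gradhx_apply]
    exact (hS.hasFDerivAt_fderiv_h
      ((hasFDerivAt_state_of_traj hξ _ θ).prodMk (hasFDerivAt_id θ)) _).differentiableAt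
  | cast t ih =>
    intro θ
    refine differentiableAt_euclidean.2 fun a => ?_
    simp only [multiplier_castSucc, hS.gradHx_apply]
    obtain ⟨D, hD, -⟩ := hS.hasFDerivAt_dH t (hasFDerivAt_point_of_traj hξ t θ)
      (ih θ).hasFDerivAt (EuclideanSpace.single a 1, 0, 0)
    exact hD.differentiableAt

/-- Total derivative of `θ ↦ ∂H_t` along `(x_t, u_t, θ, λ_{t+1})`. State directions `v` produce the
costate equation, input directions the input equation. -/
theorem Smooth.jacobian_of_dH (hS : S.Smooth) (t : Fin T) (θ : Vec r) {q : ℕ}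
    (v : Fin q → Vec n × Vec m × Vec r) {g : Vec r → Vec q}
    (hg : ∀ ϑ a, g ϑ a =
      S.dH t ((ξ ϑ).1 t.castSucc, (ξ ϑ).2 t, ϑ) (S.multiplier ϑ (ξ ϑ) t.succ) (v a))
    {Hx : Matrix (Fin q) (Fin n) ℝ} {Hu : Matrix (Fin q) (Fin m) ℝ} {Hθ : Matrix (Fin q) (Fin r) ℝ}
    {F : Matrix (Fin n) (Fin q) ℝ}
    (hHx : ∀ a c, Hx a c = S.hessH t ((ξ θ).1 t.castSucc, (ξ θ).2 t, θ)
      (S.multiplier θ (ξ θ) t.succ) (EuclideanSpace.single c 1, 0, 0) (v a))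
    (hHu : ∀ a c, Hu a c = S.hessH t ((ξ θ).1 t.castSucc, (ξ θ).2 t, θ)
      (S.multiplier θ (ξ θ) t.succ) (0, EuclideanSpace.single c 1, 0) (v a))
    (hHθ : ∀ a c, Hθ a c = S.hessH t ((ξ θ).1 t.castSucc, (ξ θ).2 t, θ)
      (S.multiplier θ (ξ θ) t.succ) (0, 0, EuclideanSpace.single c 1) (v a))
    (hF : ∀ c a, F c a = fderiv ℝ S.f ((ξ θ).1 t.castSucc, (ξ θ).2 t, θ) (v a) c) :
    jacobian g θ = Hx * jacobian (fun ϑ => (ξ ϑ).1 t.castSucc) θ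
      + Hu * jacobian (fun ϑ => (ξ ϑ).2 t) θ + Hθ
      + Fᵀ * jacobian (fun ϑ => S.multiplier ϑ (ξ ϑ) t.succ) θ := by
  choose D hD hd using fun a => hS.hasFDerivAt_dH t (hasFDerivAt_point_of_traj hξ t θ)
    (hS.differentiable_multiplier hξ t.succ θ).hasFDerivAt (v a)
  ext a b
  rw [jacobian_apply_of_hasFDerivAt (D := D) (fun a => by simpa only [hg] using hD a), hd,
    Matrix.add_apply, Matrix.add_apply, Matrix.add_apply, transpose_mul_jacobian_apply hF,
    mul_jacobian_apply (φ := fun a => (S.hessHL t ((ξ θ).1 t.castSucc, (ξ θ).2 t, θ)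
      (S.multiplier θ (ξ θ) t.succ) (v a)).comp
        (ContinuousLinearMap.inl ℝ (Vec n) (Vec m × Vec r))) (fun a c => by rw [hHx]; exact (hessHL_apply ..).symm),
    mul_jacobian_apply (φ := fun a => (S.hessHL t ((ξ θ).1 t.castSucc, (ξ θ).2 t, θ)
      (S.multiplier θ (ξ θ) t.succ) (v a)).comp
        ((ContinuousLinearMap.inr ℝ (Vec n) (Vec m × Vec r)).comp
          (ContinuousLinearMap.inl ℝ (Vec m) (Vec r)))) (fun a c => by rw [hHu]; exact (hessHL_apply ..).symm), hHθ]
  simp only [ContinuousLinearMap.comp_apply, hessHL_apply, ContinuousLinearMap.inl_apply,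
    ContinuousLinearMap.inr_apply, ContinuousLinearMap.prod_apply, ContinuousLinearMap.id_apply,
    ← hessH_add, Prod.mk_add_mk, add_zero, zero_add]

/-- Each equation is the parameter derivative of a first-order condition: dynamics, final
multiplier, multiplier recursion, and stationarity in the input. The costate is the Jacobian of the
multipliers. -/
theorem Smooth.isKKT_jacobian (hS : S.Smooth) (hopt : ∀ θ, S.IsOptimal θ (ξ θ)) (θ : Vec r) :
    (S.gradientGenerator θ (ξ θ)).IsKKT
      (fun t => jacobian (fun ϑ => (ξ ϑ).1 t) θ) (fun t => jacobian (fun ϑ => (ξ ϑ).2 t) θ)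
      (fun t => jacobian (fun ϑ => S.multiplier ϑ (ξ ϑ) t) θ) where
  feasible := by
    constructor
    · ext a b
      simp [jacobian, (hopt _).1.1]
    · intro t
      have h1 := (hS.1.1 ((ξ θ).1 t.castSucc, (ξ θ).2 t, θ)).hasFDerivAt.comp θ
        (hasFDerivAt_point_of_traj hξ t θ)
      have h2 : (fun ϑ => (ξ ϑ).1 t.succ)
          = S.f ∘ fun ϑ => ((ξ ϑ).1 t.castSucc, (ξ ϑ).2 t, ϑ) :=
        funext fun ϑ => (hopt ϑ).1.2 t
      ext a b
      rw [Matrix.add_apply, Matrix.add_apply,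
        mul_jacobian_apply (φ := fun a => (PiLp.proj 2 (fun _ => ℝ) a).comp
          ((fderiv ℝ S.f ((ξ θ).1 t.castSucc, (ξ θ).2 t, θ)).comp
            (ContinuousLinearMap.inl ℝ (Vec n) (Vec m × Vec r)))) (fun _ _ => hS.generator_F ..),
        mul_jacobian_apply (φ := fun a => (PiLp.proj 2 (fun _ => ℝ) a).comp
          ((fderiv ℝ S.f ((ξ θ).1 t.castSucc, (ξ θ).2 t, θ)).comp
            ((ContinuousLinearMap.inr ℝ (Vec n) (Vec m × Vec r)).comp
              (ContinuousLinearMap.inl ℝ (Vec m) (Vec r))))) (fun _ _ => hS.generator_G ..),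
        hS.generator_E]
      change fderiv ℝ (fun ϑ => (ξ ϑ).1 t.succ) θ _ a = _
      rw [h2, h1.fderiv]
      simp only [ContinuousLinearMap.comp_apply, ContinuousLinearMap.inl_apply,
        ContinuousLinearMap.inr_apply, ContinuousLinearMap.prod_apply,
        ContinuousLinearMap.id_apply, PiLp.proj_apply, ← PiLp.add_apply, ← map_add,
        Prod.mk_add_mk, add_zero, zero_add]
  final := by
    have h1 := fun a => hS.hasFDerivAt_fderiv_h (y := fun ϑ => ((ξ ϑ).1 (Fin.last T), ϑ))
      ((hasFDerivAt_state_of_traj hξ (Fin.last T) θ).prodMk (hasFDerivAt_id θ))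
      (EuclideanSpace.single a (1 : ℝ), 0)
    ext a b
    rw [jacobian_apply_of_hasFDerivAt (fun a => by
        simpa only [multiplier_last, hS.gradhx_apply] using h1 a), Matrix.add_apply,
      mul_jacobian_apply (φ := fun a =>
        ((fderiv ℝ (fderiv ℝ S.h) ((ξ θ).1 (Fin.last T), θ)).flip
          (EuclideanSpace.single a 1, 0)).comp (ContinuousLinearMap.inl ℝ (Vec n) (Vec r)))
        (by simp [hS.generator_HxxT]), hS.generator_HxθT]
    simp only [ContinuousLinearMap.comp_apply, ContinuousLinearMap.inl_apply,
        ContinuousLinearMap.prod_apply, ContinuousLinearMap.flip_apply,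
        ContinuousLinearMap.id_apply, ← add_apply, ← map_add,
        Prod.mk_add_mk, add_zero, zero_add]
  costate t := hS.jacobian_of_dH hξ t θ (fun a => (EuclideanSpace.single a 1, 0, 0))
    (fun ϑ a => by rw [multiplier_castSucc, hS.gradHx_apply])
    (fun _ _ => hS.generator_Hxx ..) (fun _ _ => hS.generator_Hxu ..)
    (fun _ _ => hS.generator_Hxθ ..) (fun _ _ => hS.generator_F ..)
  input t := by
    -- The input gradient of the Hamiltonian vanishes for every parameter, so its total derivative
    -- is that of the zero map.
    refine (hS.jacobian_of_dH (g := fun _ => 0) hξ t θ (fun a => (0, EuclideanSpace.single a 1, 0))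
      (fun ϑ a => ?_)
      (fun _ _ => hS.generator_Hux ..) (fun _ _ => hS.generator_Huu ..)
      (fun _ _ => hS.generator_Huθ ..) (fun _ _ => hS.generator_G ..)).symm.trans ?_
    · rw [(hopt ϑ).dH_input_eq_zero hS]
      rfl
    · ext a b
      simp [jacobian]

end Sensitivity

end OCSystem

/-! ### Chain rule for the reduced loss -/

/-- With the sensitivities of the trajectory in the place of the output of the gradient generator,
the chain rule gives the gradient of the reduced loss. -/
theorem chainRuleGradient_eq_gradient {n m r T : ℕ} {L : Traj n m T × Vec r → ℝ}
    (hL : Differentiable ℝ L) {ξ : Vec r → Traj n m T} (hξ : Differentiable ℝ ξ) (θ : Vec r) :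
    chainRuleGradient L (ξ θ) θ (fun t => jacobian (fun ϑ => (ξ ϑ).1 t) θ)
      (fun t => jacobian (fun ϑ => (ξ ϑ).2 t) θ) = gradient (fun ϑ => L (ξ ϑ, ϑ)) θ := by
  have hd := (hL (ξ θ, θ)).hasFDerivAt
  have h1 := hd.comp (ξ θ) (hasFDerivAt_prodMk_left (𝕜 := ℝ) (ξ θ) θ)
  have h2 := hd.comp θ (hasFDerivAt_prodMk_right (𝕜 := ℝ) (ξ θ) θ)
  have h3 := hd.comp (f := fun ϑ => (ξ ϑ, ϑ)) θ ((hξ θ).hasFDerivAt.prodMk (hasFDerivAt_id θ))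
  ext b
  rw [OCSystem.apply_eq_inner_single (gradient _ θ), gradient,
    InnerProductSpace.toDual_symm_apply]
  -- The `b`-th columns of all the Jacobians together form the derivative of `ξ` in the direction
  -- `e_b`.
  have e1 : ((fun t => WithLp.toLp 2 fun a => jacobian (fun ϑ => (ξ ϑ).1 t) θ a b,
      fun t => WithLp.toLp 2 fun a => jacobian (fun ϑ => (ξ ϑ).2 t) θ a b) : Traj n m T)
      = fderiv ℝ ξ θ (EuclideanSpace.single b 1) := by
    have hx : ∀ t, HasFDerivAt (fun ϑ => (ξ ϑ).1 t) _ θ := fun t =>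
      (((ContinuousLinearMap.proj (R := ℝ) t).comp
        (ContinuousLinearMap.fst ℝ (Fin (T + 1) → Vec n) (Fin T → Vec m))).hasFDerivAt).comp θ
        (hξ θ).hasFDerivAt
    have hu : ∀ t, HasFDerivAt (fun ϑ => (ξ ϑ).2 t) _ θ := fun t =>
      (((ContinuousLinearMap.proj (R := ℝ) t).comp
        (ContinuousLinearMap.snd ℝ (Fin (T + 1) → Vec n) (Fin T → Vec m))).hasFDerivAt).comp θ
        (hξ θ).hasFDerivAt
    refine Prod.ext (funext fun t => ?_) (funext fun t => ?_) <;> ext a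
    · simp [jacobian, (hx t).fderiv]
    · simp [jacobian, (hu t).fderiv]
  have h3' := congrArg (fun A : Vec r →L[ℝ] ℝ => A (EuclideanSpace.single b 1)) h3.fderiv
  have h1' := congrArg (fun A : Traj n m T →L[ℝ] ℝ =>
    A (fderiv ℝ ξ θ (EuclideanSpace.single b 1))) h1.fderiv
  have h2' := congrArg (fun A : Vec r →L[ℝ] ℝ => A (EuclideanSpace.single b 1)) h2.fderiv
  refine Eq.trans ?_ h3'.symm
  refine (congrArg₂ (· + ·) ((congrArg _ e1).trans h1') h2').trans ?_
  simp only [ContinuousLinearMap.comp_apply, ContinuousLinearMap.inl_apply,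
    ContinuousLinearMap.inr_apply, ContinuousLinearMap.prod_apply,
    ContinuousLinearMap.id_apply, ← map_add, Prod.mk_add_mk, add_zero, zero_add]

theorem chainRuleGradient_output_eq_gradient {n m r T : ℕ} {S : OCSystem n m r T} (hS : S.Smooth)
    {ξ : Vec r → Traj n m T} (hopt : ∀ θ, S.IsOptimal θ (ξ θ)) (hξ : Differentiable ℝ ξ)
    {L : Traj n m T × Vec r → ℝ} (hL : Differentiable ℝ L) {θ : Vec r}
    (hpos : (S.gradientGenerator θ (ξ θ)).SecondVariationPos)
    {X : Fin (T + 1) → Matrix (Fin n) (Fin r) ℝ} {U : Fin T → Matrix (Fin m) (Fin r) ℝ}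
    (hXU : (S.gradientGenerator θ (ξ θ)).IsOutput X U) :
    chainRuleGradient L (ξ θ) θ X U = gradient (fun ϑ => L (ξ ϑ, ϑ)) θ := by
  obtain ⟨rfl, rfl⟩ := (hS.isKKT_jacobian hξ hopt θ).eq_of_isOutput
    (hS.isSymm_gradientGenerator _ _) hpos hXU
  exact chainRuleGradient_eq_gradient hL hξ θ

open Filter

/-! ### Deterministic almost-supermartingales and convex functions -/

/-- Deterministic Robbins–Siegmund lemma. A Gronwall product bounds `1 + V` by `B = (1 + V 0) exp (∑
a)`, so the error is at most `B * a k`. Then `V - B ∑ a` is antitone and bounded below, and summing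
the inequality bounds the partial sums of `b`. -/
theorem exists_tendsto_and_summable_of_le {V a b : ℕ → ℝ} (hV : ∀ k, 0 ≤ V k)
    (ha : ∀ k, 0 ≤ a k) (hb : ∀ k, 0 ≤ b k) (hsum : Summable a)
    (h : ∀ k, V (k + 1) ≤ V k + a k * (1 + V k) - b k) :
    (∃ v, Tendsto V atTop (𝓝 v)) ∧ Summable b := by
  set A := ∑' k, a k with hA
  have hAk : ∀ k, ∑ j ∈ Finset.range k, a j ≤ A := fun k =>
    hsum.sum_le_tsum _ fun j _ => ha j
  have hbound : ∀ k, 1 + V k ≤ (1 + V 0) * Real.exp A := by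
    have h1 : ∀ k, 1 + V k ≤ (1 + V 0) * Real.exp (∑ j ∈ Finset.range k, a j) := by
      intro k
      induction k with
      | zero => simp
      | succ k ih =>
        rw [Finset.sum_range_succ, Real.exp_add, ← mul_assoc]
        calc 1 + V (k + 1) ≤ (1 + V k) * (1 + a k) := by linarith [h k, hb k]
          _ ≤ _ := by
            refine mul_le_mul ih ?_ (by linarith [ha k]) (by have := hV 0; positivity)
            linarith [Real.add_one_le_exp (a k)]
    intro k
    refine (h1 k).trans ?_
    have := hV 0
    gcongr
    exact hAk k
  set B := (1 + V 0) * Real.exp A with hB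
  have hB0 : 0 ≤ B := by have := hV 0; positivity
  have hstep : ∀ k, V (k + 1) ≤ V k + B * a k - b k := by
    intro k
    have := mul_le_mul_of_nonneg_left (hbound k) (ha k)
    linarith [h k]
  have hanti : Antitone fun k => V k - B * ∑ j ∈ Finset.range k, a j := by
    refine antitone_nat_of_succ_le fun k => ?_
    rw [Finset.sum_range_succ]
    linarith [hstep k, hb k]
  constructor
  · have hbdd : BddBelow (Set.range fun k => V k - B * ∑ j ∈ Finset.range k, a j) := by
      refine ⟨-(B * A), ?_⟩
      rintro _ ⟨k, rfl⟩
      have := mul_le_mul_of_nonneg_left (hAk k) hB0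
      simp only
      linarith [hV k]
    have h1 := (tendsto_atTop_ciInf hanti hbdd).add (hsum.hasSum.tendsto_sum_nat.const_mul B)
    exact ⟨_, h1.congr fun k => by ring⟩
  · refine summable_of_sum_range_le (c := V 0 + B * A) hb fun k => ?_
    have h1 : V k + ∑ j ∈ Finset.range k, b j ≤ V 0 + B * ∑ j ∈ Finset.range k, a j := by
      induction k with
      | zero => simp
      | succ k ih =>
        rw [Finset.sum_range_succ, Finset.sum_range_succ]
        linarith [hstep k]
    have := mul_le_mul_of_nonneg_left (hAk k) hB0
    linarith [hV k]

theorem norm_add_sq_le_of_pos {E : Type*} [SeminormedAddCommGroup E] (a b : E) {s : ℝ}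
    (hs : 0 < s) :
    ‖a + b‖ ^ 2 ≤ (1 + s) * ‖a‖ ^ 2 + (1 + s⁻¹) * ‖b‖ ^ 2 := by
  have h1 : ‖a + b‖ ^ 2 ≤ (‖a‖ + ‖b‖) ^ 2 := by
    gcongr
    exact norm_add_le a b
  have h2 : 2 * ‖a‖ * ‖b‖ ≤ s * ‖a‖ ^ 2 + s⁻¹ * ‖b‖ ^ 2 := by
    have h3 : 0 ≤ s⁻¹ * (s * ‖a‖ - ‖b‖) ^ 2 := by positivity
    have h4 : s⁻¹ * (s * ‖a‖ - ‖b‖) ^ 2 = s * ‖a‖ ^ 2 + s⁻¹ * ‖b‖ ^ 2 - 2 * ‖a‖ * ‖b‖ := by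
      field_simp
      ring
    linarith
  nlinarith

section Hilbert

variable {H : Type*} [NormedAddCommGroup H] [InnerProductSpace ℝ H]

theorem hasDerivAt_line [CompleteSpace H] {F : H → ℝ} {g y : H} (hg : HasGradientAt F g y)
    (v : H) :
    HasDerivAt (fun s : ℝ => F (y + s • v)) (inner ℝ g v) 0 := by
  have h1 : HasDerivAt (fun s : ℝ => y + s • v) v 0 := by
    simpa using ((hasDerivAt_id (0 : ℝ)).smul_const v).const_add y
  have h2 : HasFDerivAt F (InnerProductSpace.toDual ℝ H g) (y + (0 : ℝ) • v) := by
    simpa using hg.hasFDerivAt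
  exact h2.comp_hasDerivAt (0 : ℝ) h1

theorem inner_gradient_le_sub [CompleteSpace H] {F : H → ℝ} (hF : ConvexOn ℝ Set.univ F)
    {g y : H} (hg : HasGradientAt F g y) (z : H) : inner ℝ g (z - y) ≤ F z - F y := by
  have hc : ConvexOn ℝ Set.univ fun s : ℝ => F (y + s • (z - y)) := by
    refine ⟨convex_univ, fun a _ b _ s t hs ht hst => ?_⟩
    have e : y + (s • a + t • b) • (z - y) = s • (y + a • (z - y)) + t • (y + b • (z - y)) := by
      have : y = s • y + t • y := by rw [← add_smul, hst, one_smul]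
      nth_rewrite 1 [this]
      simp only [smul_add, smul_smul, add_smul, smul_eq_mul]
      abel
    simp only [e]
    exact hF.2 trivial trivial hs ht hst
  have h1 := hc.le_slope_of_hasDerivAt (Set.mem_univ (0 : ℝ)) (Set.mem_univ (1 : ℝ)) one_pos
    (hasDerivAt_line hg (z - y))
  simpa [slope_def_field] using h1

theorem gradient_mem_orthogonal_of_isMinOn [CompleteSpace H] {F : H → ℝ} {K : Submodule ℝ H}
    {g s : H} (hs : s ∈ K) (hmin : ∀ z ∈ K, F s ≤ F z) (hg : HasGradientAt F g s) : g ∈ Kᗮ := by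
  rw [Submodule.mem_orthogonal']
  intro v hv
  refine IsLocalMin.hasDerivAt_eq_zero (Eventually.of_forall fun a => ?_) (hasDerivAt_line hg v)
  simpa using hmin _ (K.add_mem hs (K.smul_mem a hv))

/-! ### Time-varying mixing operators -/

/-- The product `M (k + j - 1) ∘ ⋯ ∘ M k`. -/
def transition (M : ℕ → H →ₗ[ℝ] H) : ℕ → ℕ → H →ₗ[ℝ] H
  | _, 0 => LinearMap.id
  | k, j + 1 => transition M (k + 1) j ∘ₗ M k

/-- The operators `M k` do not increase the norm, fix the elements of `K`, preserve `Kᗮ`, and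
products of `L` consecutive ones contract `Kᗮ`. -/
structure IsMixing (M : ℕ → H →ₗ[ℝ] H) (K : Submodule ℝ H) (L : ℕ) (δ : ℝ) : Prop where
  norm_le : ∀ k z, ‖M k z‖ ≤ ‖z‖
  fix : ∀ k, ∀ z ∈ K, M k z = z
  orthogonal : ∀ k, ∀ z ∈ Kᗮ, M k z ∈ Kᗮ
  contract : ∀ k, ∀ z ∈ Kᗮ, ‖transition M k L z‖ ^ 2 ≤ (1 - δ) * ‖z‖ ^ 2

/-- The energy of `z` along the next `L` operators. -/
noncomputable def energy (M : ℕ → H →ₗ[ℝ] H) (L k : ℕ) (z : H) : ℝ :=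
  ∑ j ∈ Finset.range L, ‖transition M k j z‖ ^ 2

theorem energy_nonneg (M : ℕ → H →ₗ[ℝ] H) (L k : ℕ) (z : H) : 0 ≤ energy M L k z :=
  Finset.sum_nonneg fun _ _ => by positivity

namespace IsMixing

variable {M : ℕ → H →ₗ[ℝ] H} {K : Submodule ℝ H} {L : ℕ} {δ : ℝ}

theorem norm_transition_le (h : IsMixing M K L δ) (k j : ℕ) (z : H) :
    ‖transition M k j z‖ ≤ ‖z‖ := by
  induction j generalizing k z with
  | zero => exact le_rfl
  | succ j ih => exact (ih (k + 1) (M k z)).trans (h.norm_le k z)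

theorem energy_le (h : IsMixing M K L δ) (k : ℕ) (z : H) : energy M L k z ≤ L * ‖z‖ ^ 2 := by
  refine (Finset.sum_le_card_nsmul _ _ (‖z‖ ^ 2) fun j _ => ?_).trans (by simp)
  have := h.norm_transition_le k j z
  gcongr

/-- Shifting the window drops the term `‖z‖ ^ 2` and adds the one at its far end, which is smaller
by contraction. This gives strict decrease at every step although a single `M k` need not contract.
-/
theorem energy_map_le (h : IsMixing M K L δ) (k : ℕ) {z : H} (hz : z ∈ Kᗮ) :
    energy M L (k + 1) (M k z) ≤ energy M L k z - δ * ‖z‖ ^ 2 := by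
  have h1 : energy M L (k + 1) (M k z) + ‖z‖ ^ 2
      = energy M L k z + ‖transition M k L z‖ ^ 2 := by
    have h2 := Finset.sum_range_succ (fun j => ‖transition M k j z‖ ^ 2) L
    rw [Finset.sum_range_succ'] at h2
    exact h2
  linarith [h.contract k z hz]

theorem energy_map_add_le (h : IsMixing M K L δ) (hδ : 0 < δ) (k : ℕ) {z : H} (hz : z ∈ Kᗮ)
    (w : H) : energy M L (k + 1) (M k z + w) ≤ energy M L k z - δ / 2 * ‖z‖ ^ 2
      + (1 + (δ / (2 * (L + 1)))⁻¹) * L * ‖w‖ ^ 2 := by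
  -- Weight in Young's inequality: the loss `s * L * ‖z‖ ^ 2` must use at most half of the decrease
  -- `δ * ‖z‖ ^ 2`.
  set s : ℝ := δ / (2 * (L + 1)) with hs
  have hs0 : 0 < s := by positivity
  have hsL : s * L ≤ δ / 2 := by
    rw [hs, div_mul_eq_mul_div, div_le_div_iff₀ (by positivity) two_pos]
    nlinarith
  have h1 : energy M L (k + 1) (M k z + w)
      ≤ (1 + s) * energy M L (k + 1) (M k z) + (1 + s⁻¹) * energy M L (k + 1) w := by
    unfold energy
    rw [Finset.mul_sum, Finset.mul_sum, ← Finset.sum_add_distrib]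
    refine Finset.sum_le_sum fun j _ => ?_
    rw [map_add]
    exact norm_add_sq_le_of_pos _ _ hs0
  have h2 := mul_le_mul_of_nonneg_left (h.energy_map_le k hz) (by positivity : 0 ≤ 1 + s)
  have h3 := mul_le_mul_of_nonneg_left (h.energy_le (k + 1) w) (by positivity : 0 ≤ 1 + s⁻¹)
  have h4 := mul_le_mul_of_nonneg_left (h.energy_le k z) hs0.le
  have h5 := mul_le_mul_of_nonneg_right hsL (sq_nonneg ‖z‖)
  have h6 : 0 ≤ s * (δ * ‖z‖ ^ 2) := by positivity
  linarith

end IsMixing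

/-! ### Convergence of the distributed gradient iteration -/

section Gradient

variable [FiniteDimensional ℝ H] {M : ℕ → H →ₗ[ℝ] H} {K : Submodule ℝ H} {L : ℕ} {δ : ℝ}
  {F : H → ℝ} {G : H → H}

theorem IsMixing.starProjection_map (h : IsMixing M K L δ) (k : ℕ) (z : H) :
    Kᗮ.starProjection (M k z) = M k (Kᗮ.starProjection z) := by
  have e : z = K.starProjection z + Kᗮ.starProjection z := by
    simp [Submodule.starProjection_orthogonal]
  have h1 : Kᗮ.starProjection (K.starProjection z) = 0 :=
    Kᗮ.starProjection_apply_eq_zero_iff.2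
      (by rw [Submodule.orthogonal_orthogonal]; exact K.starProjection_apply_mem z)
  have h2 : Kᗮ.starProjection (M k (Kᗮ.starProjection z)) = M k (Kᗮ.starProjection z) :=
    Submodule.starProjection_eq_self_iff.2
      (h.orthogonal k _ (Submodule.starProjection_apply_mem _ z))
  conv_lhs => rw [e]
  rw [map_add, map_add, h.fix k _ (K.starProjection_apply_mem z), h1, h2, zero_add]

/-- Off `K` the difference `F z - F s` may be negative, so progress is measured by the Bregman
distance. The correction `⟪G s, z - s⟫` sees only the disagreement `y`, as `G s ∈ Kᗮ`; so does the
error from evaluating `G` at `z` instead of `M k z`. Young's inequality splits `2η‖G s‖‖y‖` and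
`4η‖G z‖‖y‖`, which yields the constants `2` and `5 = 1 + 4`. -/
theorem IsMixing.norm_sub_sq_le (h : IsMixing M K L δ) (hF : ConvexOn ℝ Set.univ F)
    (hG : ∀ z, HasGradientAt F (G z) z) {s : H} (hs : s ∈ K) (hmin : ∀ z ∈ K, F s ≤ F z)
    (k : ℕ) (z : H) {η : ℝ} (hη : 0 ≤ η) :
    ‖M k z - η • G z - s‖ ^ 2 ≤ ‖z - s‖ ^ 2 - 2 * η * (F z - F s - inner ℝ (G s) (z - s))
      + 2 * ‖Kᗮ.starProjection z‖ ^ 2 + η ^ 2 * (‖G s‖ ^ 2 + 5 * ‖G z‖ ^ 2) := by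
  set y := Kᗮ.starProjection z with hy
  have hp : G s ∈ Kᗮ := gradient_mem_orthogonal_of_isMinOn hs hmin (hG s)
  have hMs : M k s = s := h.fix k s hs
  have hzy : z - y ∈ K := by
    have : z - y = K.starProjection z := by simp [hy, Submodule.starProjection_orthogonal]
    rw [this]
    exact K.starProjection_apply_mem z
  have hMz : M k z - z = M k y - y := by
    have h1 := h.fix k _ hzy
    rw [map_sub] at h1
    rw [sub_eq_sub_iff_sub_eq_sub, h1]
  have e1 : M k z - η • G z - s = M k (z - s) - η • G z := by
    rw [map_sub, hMs]
    abel
  have e2 : M k (z - s) = (z - s) + (M k y - y) := by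
    rw [map_sub, hMs, ← hMz]
    abel
  have h1 : ‖M k (z - s)‖ ^ 2 ≤ ‖z - s‖ ^ 2 := by
    have := h.norm_le k (z - s)
    gcongr
  have h2 : inner ℝ (M k (z - s)) (G z) = inner ℝ (G z) (z - s) + inner ℝ (G z) (M k y - y) := by
    rw [e2, inner_add_left, real_inner_comm, real_inner_comm (M k y - y)]
  have h3 : F z - F s ≤ inner ℝ (G z) (z - s) := by
    have := inner_gradient_le_sub hF (hG z) s
    rw [← neg_sub z s, inner_neg_right] at this
    linarith
  have h4 : inner ℝ (G s) (z - s) = inner ℝ (G s) y := by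
    have : inner ℝ (G s) (z - y - s) = 0 :=
      (Submodule.mem_orthogonal' K (G s)).1 hp _ (K.sub_mem hzy hs)
    rw [show z - s = (z - y - s) + y by abel, inner_add_right, this, zero_add]
  have h5 : -(‖G s‖ * ‖y‖) ≤ inner ℝ (G s) y :=
    (abs_le.1 (abs_real_inner_le_norm (G s) y)).1
  have h6 : -(‖G z‖ * (2 * ‖y‖)) ≤ inner ℝ (G z) (M k y - y) := by
    have h7 := (abs_le.1 (abs_real_inner_le_norm (G z) (M k y - y))).1
    have h8 : ‖M k y - y‖ ≤ 2 * ‖y‖ := by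
      linarith [norm_sub_le (M k y) y, h.norm_le k y]
    have := mul_le_mul_of_nonneg_left h8 (norm_nonneg (G z))
    linarith
  rw [e1, norm_sub_sq_real, inner_smul_right, h2, norm_smul, Real.norm_of_nonneg hη, mul_pow]
  have h9 : η * (F z - F s - ‖G z‖ * (2 * ‖y‖))
      ≤ η * (inner ℝ (G z) (z - s) + inner ℝ (G z) (M k y - y)) :=
    mul_le_mul_of_nonneg_left (by linarith) hη
  have h10 : η * (-(‖G s‖ * ‖y‖)) ≤ η * inner ℝ (G s) (z - s) :=
    mul_le_mul_of_nonneg_left (by linarith) hη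
  have h11 := sq_nonneg (‖y‖ - η * ‖G s‖)
  have h12 := sq_nonneg (‖y‖ - 2 * (η * ‖G z‖))
  linarith

theorem IsMixing.gradient_iteration_of_minimizer (h : IsMixing M K L δ) (hδ : 0 < δ)
    (hF : ConvexOn ℝ Set.univ F) (hG : ∀ z, HasGradientAt F (G z) z) {s : H} (hs : s ∈ K)
    (hmin : ∀ z ∈ K, F s ≤ F z) {η : ℕ → ℝ} (hη : ∀ k, 0 < η k)
    (hηsq : Summable fun k => η k ^ 2) {z : ℕ → H}
    (hz : ∀ k, z (k + 1) = M k (z k) - η k • G (z k)) {C : ℝ}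
    (hC : ∀ k, ‖G (z k)‖ ≤ C * (1 + ‖z k‖)) :
    (∃ v, Tendsto (fun k => ‖z k - s‖ ^ 2) atTop (𝓝 v)) ∧
      Tendsto (fun k => Kᗮ.starProjection (z k)) atTop (𝓝 0) ∧
      Summable fun k => η k * (F (z k) - F s - inner ℝ (G s) (z k - s)) := by
  have hC0 : 0 ≤ C := by
    by_contra hneg
    have h1 := (norm_nonneg _).trans (hC 0)
    have h2 : C * (1 + ‖z 0‖) < 0 := mul_neg_of_neg_of_pos (not_le.1 hneg) (by positivity)
    linarith
  set y : ℕ → H := fun k => Kᗮ.starProjection (z k) with hy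
  set D : ℕ → ℝ := fun k => ‖z k - s‖ ^ 2 with hD
  set B : ℕ → ℝ := fun k => F (z k) - F s - inner ℝ (G s) (z k - s) with hB
  have hB0 : ∀ k, 0 ≤ B k := fun k => by
    have := inner_gradient_le_sub hF (hG s) (z k)
    simp only [hB]
    linarith
  have hD0 : ∀ k, 0 ≤ D k := fun k => by positivity
  -- Recentering the growth bound at `s` turns it into a bound by `1 + D k`, the form the
  -- supermartingale lemma accepts.
  set C₁ := C * (1 + ‖s‖) with hC₁
  have hg : ∀ k, ‖G (z k)‖ ^ 2 ≤ 2 * C₁ ^ 2 * (1 + D k) := by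
    intro k
    have h1 : ‖G (z k)‖ ≤ C₁ * (1 + ‖z k - s‖) := by
      refine (hC k).trans ?_
      rw [hC₁, mul_assoc]
      refine mul_le_mul_of_nonneg_left ?_ hC0
      have h2 : ‖z k‖ ≤ ‖z k - s‖ + ‖s‖ := norm_le_norm_sub_add (z k) s
      have h3 : 0 ≤ ‖s‖ * ‖z k - s‖ := by positivity
      linarith
    calc ‖G (z k)‖ ^ 2 ≤ (C₁ * (1 + ‖z k - s‖)) ^ 2 := by gcongr
      _ = C₁ ^ 2 * (1 + ‖z k - s‖) ^ 2 := by ring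
      _ ≤ C₁ ^ 2 * (2 * (1 + D k)) := by
        refine mul_le_mul_of_nonneg_left ?_ (sq_nonneg _)
        simp only [hD]
        linarith [sq_nonneg (1 - ‖z k - s‖)]
      _ = _ := by ring
  set c : ℝ := (1 + (δ / (2 * (L + 1)))⁻¹) * L with hc
  have hc0 : 0 ≤ c := by positivity
  set N : ℕ → ℝ := fun k => energy M L k (y k) with hN
  have hN0 : ∀ k, 0 ≤ N k := fun k => energy_nonneg ..
  have hNstep : ∀ k, N (k + 1) ≤ N k - δ / 2 * ‖y k‖ ^ 2
      + c * (η k ^ 2 * (2 * C₁ ^ 2 * (1 + D k))) := by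
    intro k
    have e : y (k + 1) = M k (y k) + -(η k • Kᗮ.starProjection (G (z k))) := by
      simp only [hy]
      rw [hz, map_sub, map_smul, h.starProjection_map, sub_eq_add_neg]
    have h1 := h.energy_map_add_le hδ k (Kᗮ.starProjection_apply_mem (z k))
      (-(η k • Kᗮ.starProjection (G (z k))))
    have h2 : ‖-(η k • Kᗮ.starProjection (G (z k)))‖ ^ 2
        ≤ η k ^ 2 * (2 * C₁ ^ 2 * (1 + D k)) := by
      rw [norm_neg, norm_smul, mul_pow, Real.norm_eq_abs, sq_abs]
      refine mul_le_mul_of_nonneg_left (le_trans ?_ (hg k)) (sq_nonneg _)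
      have := Kᗮ.norm_starProjection_apply_le (G (z k))
      gcongr
    simp only [hN]
    rw [e]
    exact h1.trans (by
      have := mul_le_mul_of_nonneg_left h2 hc0
      simp only [hc, hy] at this ⊢
      linarith)
  have hDstep : ∀ k, D (k + 1) ≤ D k - 2 * η k * B k + 2 * ‖y k‖ ^ 2
      + η k ^ 2 * (‖G s‖ ^ 2 + 10 * C₁ ^ 2) * (1 + D k) := by
    intro k
    have h1 := h.norm_sub_sq_le hF hG hs hmin k (z k) (hη k).le
    rw [← hz] at h1
    have h2 : ‖G s‖ ^ 2 + 5 * ‖G (z k)‖ ^ 2 ≤ (‖G s‖ ^ 2 + 10 * C₁ ^ 2) * (1 + D k) := by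
      have : 0 ≤ ‖G s‖ ^ 2 * D k := mul_nonneg (sq_nonneg _) (hD0 k)
      linarith [hg k]
    have h3 := mul_le_mul_of_nonneg_left h2 (sq_nonneg (η k))
    simp only [hD, hB, hy] at h3 ⊢
    linarith
  -- The energy then supplies a decrease of `3 * ‖y k‖ ^ 2`: two units pay for the error in
  -- `hDstep`, and one remains to be summed.
  set κ : ℝ := 6 / δ with hκ
  have hκ0 : 0 < κ := by positivity
  have hκδ : κ * δ = 6 := by
    rw [hκ]
    field_simp
  set A : ℝ := ‖G s‖ ^ 2 + 10 * C₁ ^ 2 + κ * (c * (2 * C₁ ^ 2)) with hA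
  have hA0 : 0 ≤ A := by positivity
  obtain ⟨⟨v, hv⟩, hsum⟩ := exists_tendsto_and_summable_of_le (V := fun k => D k + κ * N k)
    (a := fun k => A * η k ^ 2) (b := fun k => 2 * (η k * B k) + ‖y k‖ ^ 2)
    (fun k => add_nonneg (hD0 k) (mul_nonneg hκ0.le (hN0 k))) (fun k => by positivity)
    (fun k => by have := mul_nonneg (hη k).le (hB0 k); positivity) (hηsq.mul_left A) (fun k => by
      have h1 := mul_le_mul_of_nonneg_left (hNstep k) hκ0.le
      have h2 : 0 ≤ A * η k ^ 2 * (κ * N k) := by have := hN0 k; positivity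
      have h3 : κ * (δ / 2 * ‖y k‖ ^ 2) = 3 * ‖y k‖ ^ 2 := by
        linear_combination (‖y k‖ ^ 2 / 2) * hκδ
      have h4 : A * η k ^ 2 * (1 + D k)
          = η k ^ 2 * (‖G s‖ ^ 2 + 10 * C₁ ^ 2) * (1 + D k)
            + κ * (c * (η k ^ 2 * (2 * C₁ ^ 2 * (1 + D k)))) := by
        rw [hA]
        ring
      have h5 := hDstep k
      linarith)
  have hysum : Summable fun k => ‖y k‖ ^ 2 :=
    Summable.of_nonneg_of_le (fun k => by positivity)
      (fun k => by have := mul_nonneg (hη k).le (hB0 k); linarith) hsum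
  have hy0 : Tendsto (fun k => ‖y k‖ ^ 2) atTop (𝓝 0) := hysum.tendsto_atTop_zero
  refine ⟨⟨v, ?_⟩, ?_, ?_⟩
  · have hNlim : Tendsto N atTop (𝓝 0) :=
      squeeze_zero hN0 (fun k => h.energy_le k (y k)) (by simpa using hy0.const_mul (L : ℝ))
    simpa using hv.sub (hNlim.const_mul κ)
  · rw [tendsto_zero_iff_norm_tendsto_zero]
    simpa using hy0.sqrt
  · exact Summable.of_nonneg_of_le (fun k => mul_nonneg (hη k).le (hB0 k))
      (fun k => by have := mul_nonneg (hη k).le (hB0 k); have := sq_nonneg ‖y k‖; linarith) hsum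

/-- If `ε ≤ B k` eventually, then `η k ≤ ε⁻¹ * (η k * B k)` would make `η` summable. -/
theorem exists_lt_of_summable_mul {η B : ℕ → ℝ} (hη : ∀ k, 0 < η k) (hηsum : ¬ Summable η)
    (hsum : Summable fun k => η k * B k) {ε : ℝ} (hε : 0 < ε) : ∃ᶠ k in atTop, B k < ε := by
  intro hev
  refine hηsum ?_
  have h1 : Summable fun k => ε⁻¹ * (η k * B k) := hsum.mul_left _
  refine h1.of_norm_bounded_eventually_nat ?_
  filter_upwards [hev] with k hk
  rw [Real.norm_of_nonneg (hη k).le]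
  have h2 : ε ≤ B k := not_lt.1 hk
  have h3 := mul_le_mul_of_nonneg_left h2 (hη k).le
  rw [inv_mul_eq_div, le_div_iff₀ hε]
  exact h3

theorem IsMixing.tendsto_gradient_iteration (h : IsMixing M K L δ) (hδ : 0 < δ)
    (hF : ConvexOn ℝ Set.univ F) (hG : ∀ z, HasGradientAt F (G z) z)
    (hmin : ∃ s ∈ K, ∀ z ∈ K, F s ≤ F z) {η : ℕ → ℝ} (hη : ∀ k, 0 < η k)
    (hηsum : ¬ Summable η) (hηsq : Summable fun k => η k ^ 2) {z : ℕ → H}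
    (hz : ∀ k, z (k + 1) = M k (z k) - η k • G (z k)) {C : ℝ}
    (hC : ∀ k, ‖G (z k)‖ ≤ C * (1 + ‖z k‖)) :
    ∃ s ∈ K, (∀ x ∈ K, F s ≤ F x) ∧ Tendsto z atTop (𝓝 s) := by
  obtain ⟨s, hs, hsmin⟩ := hmin
  obtain ⟨⟨v, hv⟩, hy, hsum⟩ :=
    h.gradient_iteration_of_minimizer hδ hF hG hs hsmin hη hηsq hz hC
  obtain ⟨φ, hφ, hφB⟩ := extraction_forall_of_frequently fun n : ℕ =>
    exists_lt_of_summable_mul hη hηsum hsum (Nat.one_div_pos_of_nat (α := ℝ) (n := n))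
  have hbdd : Bornology.IsBounded (Set.range z) := by
    obtain ⟨R, hR⟩ := hv.bddAbove_range
    refine (Metric.isBounded_closedBall (x := s) (r := √R)).subset ?_
    rintro _ ⟨k, rfl⟩
    rw [Metric.mem_closedBall, dist_eq_norm]
    exact Real.le_sqrt_of_sq_le (hR ⟨k, rfl⟩)
  obtain ⟨s', -, ψ, hψ, hlim⟩ := tendsto_subseq_of_bounded hbdd fun n => Set.mem_range_self (φ n)
  have hsub : Tendsto (fun n => φ (ψ n)) atTop atTop :=
    hφ.tendsto_atTop.comp hψ.tendsto_atTop
  have hFc : Continuous F := continuous_iff_continuousAt.2 fun x =>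
    (hG x).hasFDerivAt.continuousAt
  have hs' : s' ∈ K := by
    have h1 := ((Kᗮ.starProjection).continuous.tendsto s').comp hlim
    have h2 := tendsto_nhds_unique h1 (hy.comp hsub)
    rwa [Kᗮ.starProjection_apply_eq_zero_iff, Submodule.orthogonal_orthogonal] at h2
  -- The inner product vanishes because `s' - s ∈ K` and `G s ∈ Kᗮ`, so this says `F s' ≤ F s`.
  have hBlim : F s' - F s - inner ℝ (G s) (s' - s) ≤ 0 := by
    have hcont : Continuous fun x => F x - F s - inner ℝ (G s) (x - s) := by fun_prop
    refine le_of_tendsto_of_tendsto ((hcont.tendsto s').comp hlim)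
      (tendsto_one_div_add_atTop_nhds_zero_nat.comp hψ.tendsto_atTop)
      (Eventually.of_forall fun n => (hφB (ψ n)).le)
  have hmin' : ∀ x ∈ K, F s' ≤ F x := by
    have h1 : inner ℝ (G s) (s' - s) = 0 :=
      (Submodule.mem_orthogonal' K (G s)).1
        (gradient_mem_orthogonal_of_isMinOn hs hsmin (hG s)) _ (K.sub_mem hs' hs)
    intro x hx
    linarith [hsmin x hx]
  refine ⟨s', hs', hmin', ?_⟩
  -- With `s'` as the reference minimizer the whole sequence of distances converges, and its limit
  -- can be read off along the subsequence tending to `s'`.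
  obtain ⟨⟨v', hv'⟩, -, -⟩ :=
    h.gradient_iteration_of_minimizer hδ hF hG hs' hmin' hη hηsq hz hC
  have h0 : v' = 0 := by
    refine tendsto_nhds_unique (hv'.comp hsub) ?_
    have h1 := (tendsto_iff_norm_sub_tendsto_zero.1 hlim).pow 2
    simpa [Function.comp_def] using h1
  rw [tendsto_iff_norm_sub_tendsto_zero]
  rw [h0] at hv'
  simpa using hv'.sqrt

end Gradient

end Hilbert

/-! ### Doubly stochastic matrices acting on families of vectors -/

section Network

variable {N : ℕ} {V : Type*} [NormedAddCommGroup V] [InnerProductSpace ℝ V]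

/-- The families of vectors all of whose members are equal. -/
def consensus (N : ℕ) (V : Type*) [NormedAddCommGroup V] [InnerProductSpace ℝ V] :
    Submodule ℝ (PiLp 2 fun _ : Fin N => V) where
  carrier := {z | ∀ i j, z i = z j}
  add_mem' := fun hz hy i j => by simp [hz i j, hy i j]
  zero_mem' := fun i j => by simp
  smul_mem' := fun c z hz i j => by simp [hz i j]

/-- The action of a matrix on families of vectors. -/
noncomputable def matrixAct (V : Type*) [NormedAddCommGroup V] [InnerProductSpace ℝ V]
    (A : Matrix (Fin N) (Fin N) ℝ) :
    (PiLp 2 fun _ : Fin N => V) →ₗ[ℝ] PiLp 2 fun _ : Fin N => V where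
  toFun z := WithLp.toLp 2 fun i => ∑ j, A i j • z j
  map_add' z y := by
    ext i
    simp [Finset.sum_add_distrib]
  map_smul' c z := by
    ext i
    simp [Finset.smul_sum, smul_comm c]

@[simp] theorem matrixAct_apply (A : Matrix (Fin N) (Fin N) ℝ) (z : PiLp 2 fun _ : Fin N => V)
    (i : Fin N) : matrixAct V A z i = ∑ j, A i j • z j := rfl

variable {A : Matrix (Fin N) (Fin N) ℝ}

/-- Variance identity in each row, since row `i` is a probability vector with mean `matrixAct V A z
i`. Unit column sums add the second moments up to `‖z‖ ^ 2`. -/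
theorem norm_sq_sub_norm_matrixAct_sq (hA : A ∈ doublyStochastic ℝ (Fin N))
    (z : PiLp 2 fun _ : Fin N => V) :
    ‖z‖ ^ 2 - ‖matrixAct V A z‖ ^ 2 = ∑ i, ∑ j, A i j * ‖z j - matrixAct V A z i‖ ^ 2 := by
  obtain ⟨-, hrow, hcol⟩ := mem_doublyStochastic_iff_sum.1 hA
  have h1 : ∑ i, ∑ j, A i j * ‖z j‖ ^ 2 = ‖z‖ ^ 2 := by
    rw [Finset.sum_comm, PiLp.norm_sq_eq_of_L2]
    simp only [← Finset.sum_mul, hcol, one_mul]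
  have h2 : ∀ i, ∑ j, A i j * inner ℝ (z j) (matrixAct V A z i) = ‖matrixAct V A z i‖ ^ 2 := by
    intro i
    rw [← real_inner_self_eq_norm_sq]
    conv_rhs => rw [matrixAct_apply, sum_inner]
    simp only [inner_smul_left, matrixAct_apply]
    rfl
  have h3 : ∀ i, ∑ j, A i j * ‖z j - matrixAct V A z i‖ ^ 2
      = ∑ j, A i j * ‖z j‖ ^ 2 - ‖matrixAct V A z i‖ ^ 2 := by
    intro i
    have e : ∀ j, A i j * ‖z j - matrixAct V A z i‖ ^ 2 = A i j * ‖z j‖ ^ 2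
        - 2 * (A i j * inner ℝ (z j) (matrixAct V A z i))
        + A i j * ‖matrixAct V A z i‖ ^ 2 := by
      intro j
      rw [norm_sub_sq_real]
      ring
    simp only [e, Finset.sum_add_distrib, Finset.sum_sub_distrib, ← Finset.mul_sum,
      ← Finset.sum_mul, h2, hrow]
    ring
  simp only [h3, Finset.sum_sub_distrib, h1, PiLp.norm_sq_eq_of_L2 _ (matrixAct V A z)]

theorem mul_norm_sub_sq_le (hA : A ∈ doublyStochastic ℝ (Fin N))
    (z : PiLp 2 fun _ : Fin N => V) (i j : Fin N) :
    A i j * ‖z j - matrixAct V A z i‖ ^ 2 ≤ ‖z‖ ^ 2 - ‖matrixAct V A z‖ ^ 2 := by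
  have hnn := (mem_doublyStochastic_iff_sum.1 hA).1
  have h0 : ∀ i j, 0 ≤ A i j * ‖z j - matrixAct V A z i‖ ^ 2 := fun i j =>
    mul_nonneg (hnn i j) (sq_nonneg _)
  rw [norm_sq_sub_norm_matrixAct_sq hA]
  exact (Finset.single_le_sum (f := fun j => A i j * ‖z j - matrixAct V A z i‖ ^ 2)
    (fun j _ => h0 i j) (Finset.mem_univ j)).trans
    (Finset.single_le_sum (f := fun i => ∑ j, A i j * ‖z j - matrixAct V A z i‖ ^ 2)
      (fun i _ => Finset.sum_nonneg fun j _ => h0 i j) (Finset.mem_univ i))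

theorem norm_matrixAct_le (hA : A ∈ doublyStochastic ℝ (Fin N))
    (z : PiLp 2 fun _ : Fin N => V) : ‖matrixAct V A z‖ ≤ ‖z‖ := by
  have hnn := (mem_doublyStochastic_iff_sum.1 hA).1
  refine (sq_le_sq₀ (norm_nonneg _) (norm_nonneg _)).1 (sub_nonneg.1 ?_)
  rw [norm_sq_sub_norm_matrixAct_sq hA]
  exact Finset.sum_nonneg fun i _ => Finset.sum_nonneg fun j _ =>
    mul_nonneg (hnn i j) (sq_nonneg _)

theorem matrixAct_of_mem_consensus (hA : A ∈ doublyStochastic ℝ (Fin N))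
    {z : PiLp 2 fun _ : Fin N => V} (hz : z ∈ consensus N V) : matrixAct V A z = z := by
  obtain ⟨-, hrow, -⟩ := mem_doublyStochastic_iff_sum.1 hA
  ext i
  rw [matrixAct_apply, Finset.sum_congr rfl fun j _ => by rw [hz j i], ← Finset.sum_smul,
    hrow, one_smul]

theorem matrixAct_mem_orthogonal (hA : A ∈ doublyStochastic ℝ (Fin N))
    {z : PiLp 2 fun _ : Fin N => V} (hz : z ∈ (consensus N V)ᗮ) :
    matrixAct V A z ∈ (consensus N V)ᗮ := by
  obtain ⟨-, -, hcol⟩ := mem_doublyStochastic_iff_sum.1 hA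
  rw [Submodule.mem_orthogonal] at hz ⊢
  intro x hx
  rw [← hz x hx, PiLp.inner_apply, PiLp.inner_apply]
  have e : ∀ i, inner ℝ (x i) (matrixAct V A z i) = ∑ j, A i j * inner ℝ (x j) (z j) := by
    intro i
    rw [matrixAct_apply, inner_sum]
    refine Finset.sum_congr rfl fun j _ => ?_
    rw [inner_smul_right, hx i j]
  simp only [e]
  rw [Finset.sum_comm]
  simp only [← Finset.sum_mul, hcol, one_mul]

/-! ### Connectivity and contraction -/

theorem StronglyConnected.mono {W : Type*} {e e' : W → W → Prop} (h : StronglyConnected e)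
    (hle : ∀ i j, e i j → e' i j) : StronglyConnected e' :=
  fun i j => Relation.ReflTransGen.mono hle _ _ (h i j)

theorem exists_norm_sub_le_of_reflTransGen {V W : Type*} [SeminormedAddCommGroup V] {e : W → W → Prop} {i j : W}
    (h : Relation.ReflTransGen e i j) : ∃ c : ℕ, ∀ (z : W → V) (b : ℝ),
      (∀ i j, e i j → ‖z i - z j‖ ≤ b) → ‖z i - z j‖ ≤ c * b := by
  induction h with
  | refl => exact ⟨0, fun z b _ => by simp⟩
  | @tail p q _ hpq ih =>
    obtain ⟨c, hc⟩ := ih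
    refine ⟨c + 1, fun z b hb => ?_⟩
    push_cast
    linarith [norm_sub_le_norm_sub_add_norm_sub (z i) (z p) (z q), hc z b hb, hb _ _ hpq]

/-- A path gives the bound with its length as constant. On a finite vertex set there are finitely
many relations and pairs, so one constant serves all graphs; this is what makes the contraction
uniform in time. -/
theorem exists_norm_sub_le_of_stronglyConnected (V W : Type*) [SeminormedAddCommGroup V]
    [Finite W] :
    ∃ c : ℕ, ∀ e : W → W → Prop, StronglyConnected e → ∀ (z : W → V) (b : ℝ), 0 ≤ b →
      (∀ i j, e i j → ‖z i - z j‖ ≤ b) → ∀ i j, ‖z i - z j‖ ≤ c * b := by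
  have h : ∀ p : (W → W → Prop) × W × W, ∃ c : ℕ, Relation.ReflTransGen p.1 p.2.1 p.2.2 →
      ∀ (z : W → V) (b : ℝ), (∀ i j, p.1 i j → ‖z i - z j‖ ≤ b) →
        ‖z p.2.1 - z p.2.2‖ ≤ c * b := by
    intro p
    by_cases hp : Relation.ReflTransGen p.1 p.2.1 p.2.2
    · obtain ⟨c, hc⟩ := exists_norm_sub_le_of_reflTransGen (V := V) hp
      exact ⟨c, fun _ => hc⟩
    · exact ⟨0, fun h => absurd h hp⟩
  choose c hc using h
  obtain ⟨C, hC⟩ := (Set.finite_range c).bddAbove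
  refine ⟨C, fun e he z b hb hz i j => (hc (e, i, j) (he i j) z b hz).trans ?_⟩
  have : c (e, i, j) ≤ C := hC ⟨_, rfl⟩
  gcongr

theorem transition_succ_apply {H : Type*} [NormedAddCommGroup H] [InnerProductSpace ℝ H]
    (M : ℕ → H →ₗ[ℝ] H) (k j : ℕ) (z : H) :
    transition M k (j + 1) z = M (k + j) (transition M k j z) := by
  induction j generalizing k z with
  | zero => rfl
  | succ j ih =>
    have h1 := ih (k + 1) (M k z)
    rw [Nat.add_right_comm, Nat.add_assoc] at h1
    exact h1

/-- Against the constant family `x` with value `z i₀`, orthogonality gives `‖z‖ ^ 2 ≤ ‖z - x‖ ^ 2`,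
and the members of `z - x` are pairwise differences. -/
theorem norm_sq_le_of_mem_orthogonal {z : PiLp 2 fun _ : Fin N => V}
    (hz : z ∈ (consensus N V)ᗮ) {b : ℝ} (hb : ∀ i j, ‖z i - z j‖ ≤ b) :
    ‖z‖ ^ 2 ≤ N * b ^ 2 := by
  rcases isEmpty_or_nonempty (Fin N) with hN | ⟨⟨i₀⟩⟩
  · rw [PiLp.norm_sq_eq_of_L2, Finset.univ_eq_empty, Finset.sum_empty]
    positivity
  · set x : PiLp 2 fun _ : Fin N => V := WithLp.toLp 2 fun _ => z i₀ with hx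
    have hxz : inner ℝ x z = 0 := (Submodule.mem_orthogonal _ _).1 hz x fun _ _ => rfl
    have h1 : ‖z - x‖ ^ 2 = ‖z‖ ^ 2 + ‖x‖ ^ 2 := by
      rw [norm_sub_sq_real, real_inner_comm, hxz]
      ring
    have h2 : ‖z - x‖ ^ 2 ≤ N * b ^ 2 := by
      rw [PiLp.norm_sq_eq_of_L2]
      refine (Finset.sum_le_card_nsmul _ _ (b ^ 2) fun i _ => ?_).trans (by simp)
      have := hb i i₀
      simp only [hx, PiLp.sub_apply]
      gcongr
    linarith [sq_nonneg ‖x‖]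

variable {nbr : ℕ → Fin N → Finset (Fin N)} {w : ℕ → Fin N → Fin N → ℝ}

/-- A small loss of norm over the window makes every active edge short, by the variance identity and
the lower bound on weights. Self-loops are edges too, so no agent drifts far, and two agents joined
at any time of the window were already close at its start. -/
theorem norm_sub_le_of_unionEdge (hself : ∀ k i, i ∈ nbr k i) {α : ℝ} (hα : 0 < α)
    (hw : ∀ k i, ∀ j ∈ nbr k i, α ≤ w k i j)
    (hW : ∀ k, weightMatrix (nbr k) (w k) ∈ doublyStochastic ℝ (Fin N)) (k L : ℕ)
    (z : PiLp 2 fun _ : Fin N => V) {i j : Fin N}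
    (hij : UnionEdge nbr (Finset.Ico k (k + L)) j i) :
    ‖z j - z i‖ ≤ 2 * L * √((‖z‖ ^ 2
      - ‖transition (fun k => matrixAct V (weightMatrix (nbr k) (w k))) k L z‖ ^ 2) / α) := by
  set M : ℕ → (PiLp 2 fun _ : Fin N => V) →ₗ[ℝ] PiLp 2 fun _ : Fin N => V :=
    fun k => matrixAct V (weightMatrix (nbr k) (w k)) with hM
  set y : ℕ → PiLp 2 fun _ : Fin N => V := fun s => transition M k s z with hy
  have hstep : ∀ s, y (s + 1) = M (k + s) (y s) := fun s => transition_succ_apply M k s z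
  have hanti : Antitone fun s => ‖y s‖ ^ 2 := by
    refine antitone_nat_of_succ_le fun s => ?_
    have := norm_matrixAct_le (hW (k + s)) (y s)
    rw [hstep]
    gcongr
  have hy0 : y 0 = z := rfl
  have hyL : transition M k L z = y L := rfl
  rw [hyL]
  clear_value y
  have hanti' : ∀ {a b : ℕ}, a ≤ b → ‖y b‖ ^ 2 ≤ ‖y a‖ ^ 2 := fun hab => hanti hab
  set b := √((‖z‖ ^ 2 - ‖y L‖ ^ 2) / α) with hb
  have hb0 : 0 ≤ b := Real.sqrt_nonneg _
  have hedge : ∀ s < L, ∀ i, ∀ j ∈ nbr (k + s) i, ‖y s j - y (s + 1) i‖ ≤ b := by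
    intro s hs i j hj
    refine Real.le_sqrt_of_sq_le ?_
    rw [le_div_iff₀ hα, mul_comm]
    have h1 := mul_norm_sub_sq_le (hW (k + s)) (y s) i j
    have h2 : α ≤ weightMatrix (nbr (k + s)) (w (k + s)) i j := by
      simpa [weightMatrix, hj] using hw _ _ _ hj
    have h3 := mul_le_mul_of_nonneg_right h2 (sq_nonneg ‖y s j - y (s + 1) i‖)
    have h4 : ‖y s‖ ^ 2 ≤ ‖z‖ ^ 2 := hy0 ▸ hanti' (Nat.zero_le s)
    have h5 : ‖y L‖ ^ 2 ≤ ‖y (s + 1)‖ ^ 2 := hanti' (Nat.succ_le_of_lt hs)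
    rw [hstep] at h3 h5 ⊢
    exact h3.trans (h1.trans (by linarith))
  have hdrift : ∀ i, ∀ s ≤ L, ‖z i - y s i‖ ≤ s * b := by
    intro i s
    induction s with
    | zero => intro _; simp [hy0]
    | succ s ih =>
      intro hs
      push_cast
      linarith [norm_sub_le_norm_sub_add_norm_sub (z i) (y s i) (y (s + 1) i),
        ih (by omega), hedge s hs i i (hself _ _)]
  obtain ⟨k', hk', hj⟩ := hij
  obtain ⟨hk1, hk2⟩ := Finset.mem_Ico.1 hk'
  obtain ⟨s, rfl⟩ := Nat.exists_eq_add_of_le hk1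
  have hs : s < L := by omega
  have h1 := hdrift j s hs.le
  have h2 := hedge s hs i j hj
  have h3 := hdrift i (s + 1) hs
  have h4 := norm_sub_le_norm_sub_add_norm_sub (z j) (y s j) (z i)
  have h5 := norm_sub_le_norm_sub_add_norm_sub (y s j) (y (s + 1) i) (z i)
  rw [norm_sub_rev (z i)] at h3
  -- The drift of `j` costs `s`, the edge `1`, and the drift of `i` costs `s + 1`: altogether `2 *
  -- (s + 1) ≤ 2 * L`.
  have h6 : (s : ℝ) + 1 ≤ L := by exact_mod_cast hs
  have h7 := mul_le_mul_of_nonneg_right h6 hb0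
  push_cast at h3
  linarith

variable (V) in
theorem exists_isMixing (hself : ∀ k i, i ∈ nbr k i) {α : ℝ} (hα : 0 < α)
    (hw : ∀ k i, ∀ j ∈ nbr k i, α ≤ w k i j)
    (hW : ∀ k, weightMatrix (nbr k) (w k) ∈ doublyStochastic ℝ (Fin N)) {L : ℕ}
    (hconn : ∀ k, StronglyConnected (UnionEdge nbr (Finset.Ico k (k + L)))) :
    ∃ δ : ℝ, 0 < δ ∧ IsMixing (fun k => matrixAct V (weightMatrix (nbr k) (w k)))
      (consensus N V) L δ := by
  obtain ⟨c, hc⟩ := exists_norm_sub_le_of_stronglyConnected V (Fin N)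
  -- Ratio bounding `‖z‖ ^ 2` by the loss of squared norm over a window; the added `1` only ensures
  -- positivity.
  set γ : ℝ := N * (c * (2 * L)) ^ 2 / α + 1 with hγ
  have hγ0 : 0 < γ := by positivity
  refine ⟨γ⁻¹, inv_pos.2 hγ0, fun k => norm_matrixAct_le (hW k),
    fun k z hz => matrixAct_of_mem_consensus (hW k) hz,
    fun k z hz => matrixAct_mem_orthogonal (hW k) hz, fun k z hz => ?_⟩
  set M : ℕ → (PiLp 2 fun _ : Fin N => V) →ₗ[ℝ] PiLp 2 fun _ : Fin N => V :=
    fun k => matrixAct V (weightMatrix (nbr k) (w k)) with hM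
  set ε := ‖z‖ ^ 2 - ‖transition M k L z‖ ^ 2 with hε
  have hε0 : 0 ≤ ε := by
    have h1 : ∀ j k z, ‖transition M k j z‖ ≤ ‖z‖ := by
      intro j
      induction j with
      | zero => exact fun _ _ => le_rfl
      | succ j ih => exact fun k z => (ih (k + 1) (M k z)).trans (norm_matrixAct_le (hW k) z)
    have := h1 L k z
    rw [hε, sub_nonneg]
    gcongr
  have h1 := norm_sq_le_of_mem_orthogonal hz (hc _ (hconn k) z (2 * L * √(ε / α)) (by positivity)
    fun j i hij => norm_sub_le_of_unionEdge hself hα hw hW k L z hij)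
  have h2 : N * (c * (2 * L * √(ε / α))) ^ 2 = (γ - 1) * ε := by
    rw [mul_pow, mul_pow, Real.sq_sqrt (div_nonneg hε0 hα.le), hγ]
    ring
  have h3 : ‖z‖ ^ 2 ≤ γ * ε := by linarith
  have h4 : γ⁻¹ * ‖z‖ ^ 2 ≤ ε := by rwa [inv_mul_le_iff₀ hγ0]
  linarith

/-- Every interval of length `2 * l` contains a complete aligned window of length `l`: the one
starting at the first multiple of `l` that is at least `k`. -/
theorem stronglyConnected_Ico_of_windows {t l : ℕ} (hl : 0 < l)
    (h : ∀ k : ℕ, StronglyConnected (UnionEdge nbr (Finset.Icc (k * l + t) (k * l + t + l - 1))))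
    (k : ℕ) : StronglyConnected
      (UnionEdge (fun k => nbr (k + t)) (Finset.Ico k (k + 2 * l))) := by
  refine (h ((k + l - 1) / l)).mono fun i j ⟨s, hs, hij⟩ => ?_
  obtain ⟨h1, h2⟩ := Finset.mem_Icc.1 hs
  have h3 := Nat.div_mul_le_self (k + l - 1) l
  have h4 := Nat.lt_div_mul_add (a := k + l - 1) hl
  refine ⟨s - t, Finset.mem_Ico.2 ⟨by omega, by omega⟩, ?_⟩
  simp only
  rwa [Nat.sub_add_cancel (by omega)]

end Network

/-! ### Sums of functions of the members of a family -/

section Separable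

variable {N : ℕ} {V : Type*} [NormedAddCommGroup V] [InnerProductSpace ℝ V]
  {f : Fin N → V → ℝ}

theorem convexOn_sum_apply (hf : ∀ i, ConvexOn ℝ Set.univ (f i)) :
    ConvexOn ℝ Set.univ fun z : PiLp 2 fun _ : Fin N => V => ∑ i, f i (z i) := by
  refine ⟨convex_univ, fun x _ y _ a b ha hb hab => ?_⟩
  simp only [smul_eq_mul, Finset.mul_sum, ← Finset.sum_add_distrib]
  exact Finset.sum_le_sum fun i _ => (hf i).2 trivial trivial ha hb hab

theorem hasGradientAt_sum_apply [CompleteSpace V] (hf : ∀ i, Differentiable ℝ (f i))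
    (z : PiLp 2 fun _ : Fin N => V) :
    HasGradientAt (fun z : PiLp 2 fun _ : Fin N => V => ∑ i, f i (z i))
      (WithLp.toLp 2 fun i => gradient (f i) (z i)) z := by
  have h1 : ∀ i ∈ Finset.univ, HasFDerivAt (fun z : PiLp 2 fun _ : Fin N => V => f i (z i))
      ((fderiv ℝ (f i) (z i)).comp (PiLp.proj (𝕜 := ℝ) 2 (fun _ : Fin N => V) i)) z :=
    fun i _ => HasFDerivAt.comp z (hf i (z i)).hasFDerivAt
      (PiLp.proj (𝕜 := ℝ) 2 (fun _ : Fin N => V) i).hasFDerivAt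
  rw [hasGradientAt_iff_hasFDerivAt]
  refine (HasFDerivAt.fun_sum h1).congr_fderiv ?_
  ext v
  simp [PiLp.inner_apply, gradient]

end Separable

theorem norm_le_of_apply_le {N : ℕ} {V : Type*} [SeminormedAddCommGroup V]
    {g z : PiLp 2 fun _ : Fin N => V} {C : ℝ}
    (h : ∀ i, ‖g i‖ ≤ C * (1 + ‖z i‖)) : ‖g‖ ≤ √N * |C| * (1 + ‖z‖) := by
  refine (sq_le_sq₀ (norm_nonneg _) (by positivity)).1 ?_
  rw [PiLp.norm_sq_eq_of_L2, mul_pow, mul_pow, Real.sq_sqrt (Nat.cast_nonneg _), mul_assoc]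
  refine (Finset.sum_le_card_nsmul _ _ ((|C| ^ 2) * (1 + ‖z‖) ^ 2) fun i _ => ?_).trans (by simp)
  rw [← mul_pow]
  have h1 : ‖g i‖ ≤ |C| * (1 + ‖z‖) := by
    refine (h i).trans (mul_le_mul (le_abs_self C) ?_ (by positivity) (abs_nonneg C))
    linarith [PiLp.norm_apply_le z i]
  gcongr

theorem not_summable_add_of_tendsto {η : ℕ → ℝ} (hη : ∀ k, 0 < η k)
    (h : Tendsto (fun K => ∑ k ∈ Finset.range K, η k) atTop atTop) (t : ℕ) :
    ¬ Summable fun k => η (k + t) := by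
  rw [summable_nat_add_iff t, not_summable_iff_tendsto_nat_atTop_of_nonneg fun k => (hη k).le]
  exact h

end CoopTuning

/-! ### Assembly of the two halves -/

theorem theorem1
    {N n m r T : ℕ}
    -- the agents' optimal control systems, twice differentiable
    (S : Fin N → CoopTuning.OCSystem n m r T)
    (hS : ∀ i, (S i).Smooth)
    -- the unique optimal trajectories, differentiable in the parameter and nondegenerate
    (ξ : Fin N → CoopTuning.Vec r → CoopTuning.Traj n m T)
    (hξ : ∀ i θ ζ, (S i).IsOptimal θ ζ ↔ ζ = ξ i θ)
    (hξd : ∀ i, Differentiable ℝ (ξ i))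
    (hξ2 : ∀ i θ, ((S i).gradientGenerator θ (ξ i θ)).SecondVariationPos)
    -- the local losses, convex as functions of the parameter alone
    (L : Fin N → CoopTuning.Traj n m T × CoopTuning.Vec r → ℝ)
    (hL : ∀ i, Differentiable ℝ (L i))
    (hconv : ∀ i, ConvexOn ℝ Set.univ (fun θ => L i (ξ i θ, θ)))
    (hsol : ∃ θs, CoopTuning.SolvesTuning L ξ θs)
    -- the neighbor sets and the weights
    (nbr : ℕ → Fin N → Finset (Fin N))
    (w : ℕ → Fin N → Fin N → ℝ)
    (hself : ∀ k i, i ∈ nbr k i)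
    (hw : ∃ α : ℝ, 0 < α ∧ ∀ k i, ∀ j ∈ nbr k i, α ≤ w k i j)
    (hW : ∀ k, CoopTuning.weightMatrix (nbr k) (w k) ∈ doublyStochastic ℝ (Fin N))
    (hconn : ∃ τ l : ℕ, 0 < τ ∧ 0 < l ∧ ∀ k : ℕ,
      CoopTuning.StronglyConnected
        (CoopTuning.UnionEdge nbr (Finset.Icc (k * l + 1 + τ) ((k + 1) * l + τ))))
    -- the step sizes
    (η : ℕ → ℝ)
    (hηpos : ∀ k, 0 < η k)
    (hηlim : Filter.Tendsto η Filter.atTop (𝓝 0))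
    (hηsum : Filter.Tendsto (fun K => ∑ k ∈ Finset.range K, η k) Filter.atTop Filter.atTop)
    (hηsq : Summable (fun k => η k ^ 2))
    -- the iterates, with the output of the gradient generator at each of them
    (θ : ℕ → Fin N → CoopTuning.Vec r)
    (X : ℕ → Fin N → Fin (T + 1) → Matrix (Fin n) (Fin r) ℝ)
    (U : ℕ → Fin N → Fin T → Matrix (Fin m) (Fin r) ℝ)
    (hXU : ∀ k i, ((S i).gradientGenerator (θ k i) (ξ i (θ k i))).IsOutput (X k i) (U k i))
    (hupdate : ∀ k i, θ (k + 1) i = (∑ j ∈ nbr k i, w k i j • θ k j)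
      - η k • CoopTuning.chainRuleGradient (L i) (ξ i (θ k i)) (θ k i) (X k i) (U k i))
    -- along the iterates the gradients of the losses grow at most linearly
    (hgrowth : ∃ C : ℝ, ∀ k i,
      ‖gradient (fun ϑ => L i (ξ i ϑ, ϑ)) (θ k i)‖ ≤ C * (1 + ‖θ k i‖)) :
    ∃ θs : CoopTuning.Vec r,
      (∀ i, Filter.Tendsto (fun k => θ k i) Filter.atTop (𝓝 θs)) ∧
        CoopTuning.SolvesTuning L ξ θs := by
  open CoopTuning in
  obtain ⟨α, hα, hw⟩ := hw
  obtain ⟨τ, l, -, hl, hconn⟩ := hconn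
  obtain ⟨C, hC⟩ := hgrowth
  obtain ⟨θ₀, hθ₀⟩ := hsol
  rcases isEmpty_or_nonempty (Fin N) with hN | ⟨⟨i₀⟩⟩
  · exact ⟨θ₀, fun i => (hN.false i).elim, hθ₀⟩
  have hgrad : ∀ k i, chainRuleGradient (L i) (ξ i (θ k i)) (θ k i) (X k i) (U k i)
      = gradient (fun ϑ => L i (ξ i ϑ, ϑ)) (θ k i) := fun k i =>
    chainRuleGradient_output_eq_gradient (hS i) (fun ϑ => (hξ i ϑ _).2 rfl) (hξd i) (hL i)
      (hξ2 i _) (hXU k i)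
  have hdiff : ∀ i, Differentiable ℝ fun ϑ => L i (ξ i ϑ, ϑ) := fun i =>
    (hL i).comp ((hξd i).prodMk differentiable_id)
  have hteam : ∀ ϑ : Fin N → Vec r, teamLoss L ξ ϑ = (1 / (N : ℝ)) * ∑ i, L i (ξ i (ϑ i), ϑ i) :=
    fun _ => rfl
  have hNpos : 0 < 1 / (N : ℝ) := by
    have : 0 < N := i₀.pos
    positivity
  -- The connected windows begin at `τ + 1`, so the iteration is restarted there; the discarded
  -- iterates do not affect the limit.
  have hconn' := stronglyConnected_Ico_of_windows (nbr := nbr) (t := τ + 1) hl fun k => by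
    convert hconn k using 3
    · ring
    · rw [Nat.succ_mul]
      omega
  obtain ⟨δ, hδ, hmix⟩ := exists_isMixing (Vec r) (nbr := fun k => nbr (k + (τ + 1)))
    (w := fun k => w (k + (τ + 1))) (fun k => hself _) hα (fun k => hw _) (fun k => hW _) hconn'
  -- Minimizing the separable sum over the consensus subspace is the team problem without the factor
  -- `1 / N`.
  obtain ⟨s, hs, hsmin, hlim⟩ := hmix.tendsto_gradient_iteration hδ (convexOn_sum_apply hconv)
    (hasGradientAt_sum_apply hdiff)
    ⟨WithLp.toLp 2 fun _ => θ₀, fun _ _ => rfl, fun z hz =>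
      le_of_mul_le_mul_left (hθ₀ (fun i => z i) hz) hNpos⟩
    (η := fun k => η (k + (τ + 1))) (fun k => hηpos _)
    (not_summable_add_of_tendsto hηpos hηsum _) ((summable_nat_add_iff (τ + 1)).2 hηsq)
    (z := fun k => WithLp.toLp 2 (θ (k + (τ + 1))))
    (fun k => by
      ext1 i
      have h1 := hupdate (k + (τ + 1)) i
      rw [hgrad, Nat.add_right_comm] at h1
      simpa [weightMatrix, ite_smul, Finset.sum_ite_mem] using h1)
    (C := √N * |C|) (fun k => norm_le_of_apply_le fun i => hC _ i)
  refine ⟨s i₀, fun i => ?_, fun ϑ hϑ => ?_⟩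
  · rw [← Filter.tendsto_add_atTop_iff_nat (τ + 1), hs i₀ i]
    exact ((PiLp.continuous_apply 2 (fun _ : Fin N => Vec r) i).tendsto s).comp hlim
  · rw [hteam, hteam]
    refine mul_le_mul_of_nonneg_left ?_ hNpos.le
    refine le_trans (le_of_eq ?_) (hsmin (WithLp.toLp 2 ϑ) hϑ)
    exact Finset.sum_congr rfl fun i _ => by rw [hs i₀ i]
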